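/- Let $j:\mathbb R^3\to[0,+\infty]$ be a Borel-measurable function such that (J1) $j(-z)=j(z)$ for all $z\in\mathbb R^3$; (J2) $\int_{\mathbb R^3}\min\{1,|z|^2\}\,j(z)\,dz<+\infty$; (J3) $\int_{B_R}j(z)\,dz=+\infty$ for every $R>0$, where $B_R$ denotes the open ball of radius $R$ centered at the origin of $\mathbb R^3$. For a bounded open set $\Omega\subset\mathbb R^3$ let $$\mathcal J_\Omega(m)=\iint_{\Omega\times\Omega}j(x-y)\,|m(x)-m(y)|^2\,dx\,dy,\qquad \mathcal X^j(\Omega;\mathbb S^2)=\{m\in L^2(\Omega;\mathbb R^3): |m|=1\text{ a.e. in }\Omega,\ \mathcal J_\Omega(m)<+\infty\}.$$ For $m\in L^2(\Omega;\mathbb R^3)$ let $h_d[m]$ be the unique field in $L^2(\mathbb R^3;\mathbb R^3)$ satisfying, in the sense of distributions on $\mathbb R^3$, $\operatorname{div}(m\chi_\Omega+h_d[m])=0$ and $\operatorname{curl}h_d[m]=0$, where $m\chi_\Omega$ is the extension of $m$ by zero outside $\Omega$. Set $$\mathcal W_\Omega(m)=-\int_\Omega h_d[m]\cdot m\,dx,\qquad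 \mathcal E_\Omega(m)=\mathcal J_\Omega(m)+\mathcal W_\Omega(m).$$ **Theorem (Large bodies).** There exists $R^{**}=R^{**}(j)>0$ such that for every $R\ge R^{**}$, every minimizer $m_*$ of $\mathcal E_{B_R}$ on $\mathcal X^j(B_R;\mathbb S^2)$ is non-constant, i.e. there is no $c\in\mathbb R^3$ with $m_*=c$ a.e. in $B_R$. -/

import Mathlib

open MeasureTheory Metric
open scoped ENNReal ContDiff

noncomputable section

namespace Micromagnetics

/-- Euclidean three-space. -/
abbrev E3 : Type := EuclideanSpace ℝ (Fin 3)

/-- The partial derivative of `φ` in the `i`-th coordinate direction. -/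
def partialDeriv (i : Fin 3) (φ : E3 → ℝ) (x : E3) : ℝ :=
  fderiv ℝ φ x (EuclideanSpace.single i 1)

/-- `div F = 0` in the sense of distributions on the whole space:
`∫ F · ∇φ = 0` for every smooth compactly supported `φ`. -/
def WeaklyDivFree (F : E3 → E3) : Prop :=
  ∀ φ : E3 → ℝ, ContDiff ℝ ∞ φ → HasCompactSupport φ →
    ∫ x, ∑ i, F x i * partialDeriv i φ x = 0

/-- `curl F = 0` in the sense of distributions on the whole space: each component
`∂ᵢ Fⱼ - ∂ⱼ Fᵢ` vanishes when tested against smooth compactly supported functions. -/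
def WeaklyCurlFree (F : E3 → E3) : Prop :=
  ∀ φ : E3 → ℝ, ContDiff ℝ ∞ φ → HasCompactSupport φ → ∀ i j : Fin 3,
    ∫ x, (F x j * partialDeriv i φ x - F x i * partialDeriv j φ x) = 0

/-- `h` is a square-integrable solution of the magnetostatic Maxwell equations
`div (M + h) = 0`, `curl h = 0` on the whole space. -/
structure IsDemagField (M h : E3 → E3) : Prop where
  memLp : MemLp h 2 volume
  div_eq : WeaklyDivFree (fun x => M x + h x)
  curl_eq : WeaklyCurlFree h

/-- The demagnetizing field generated by `M`: the solution of the Maxwell equations in `L²`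
(for `M` in `L²` it exists and is unique up to null sets). -/
def demagField (M : E3 → E3) : E3 → E3 :=
  Classical.epsilon (IsDemagField M)

/-- The magnetostatic self-energy `-∫_Ω h_d[m] · m`, where `m` is extended by zero outside `Ω`
in the Maxwell equations. -/
def magnetostaticEnergy (Ω : Set E3) (m : E3 → E3) : ℝ :=
  - ∫ x in Ω, inner ℝ (demagField (Ω.indicator m) x) (m x)

/-- The nonlocal exchange energy `∬_{Ω × Ω} j(x - y) |m(x) - m(y)|² dx dy`, with values in
`[0, ∞]`. -/
def exchangeEnergy (j : E3 → ℝ≥0∞) (Ω : Set E3) (m : E3 → E3) : ℝ≥0∞ :=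
  ∫⁻ p in Ω ×ˢ Ω, j (p.1 - p.2) * ‖m p.1 - m p.2‖ₑ ^ 2

/-- The class of square-integrable fields on `Ω` with values in the unit sphere almost everywhere
and finite exchange energy. Fields are represented by functions on the whole space, of which only
the values on `Ω` matter. -/
def admissible (j : E3 → ℝ≥0∞) (Ω : Set E3) : Set (E3 → E3) :=
  {m | MemLp m 2 (volume.restrict Ω) ∧ (∀ᵐ x ∂volume.restrict Ω, m x ∈ sphere (0 : E3) 1) ∧
    exchangeEnergy j Ω m < ⊤}

/-- The total micromagnetic energy of an admissible field (the exchange energy is finite on the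
admissible class, so no value is lost in passing to the reals). -/
def totalEnergy (j : E3 → ℝ≥0∞) (Ω : Set E3) (m : E3 → E3) : ℝ :=
  (exchangeEnergy j Ω m).toReal + magnetostaticEnergy Ω m

/-- `m` minimizes the total energy on the admissible class. -/
def IsMinimizer (j : E3 → ℝ≥0∞) (Ω : Set E3) (m : E3 → E3) : Prop :=
  m ∈ admissible j Ω ∧ IsMinOn (totalEnergy j Ω) (admissible j Ω) m

/-- `m` is (almost everywhere) equal to a constant on `Ω`. -/
def IsConstantOn (Ω : Set E3) (m : E3 → E3) : Prop :=
  ∃ c : E3, ∀ᵐ x ∂volume.restrict Ω, m x = c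

end Micromagnetics

end

namespace Micromagnetics

open Filter Topology
open scoped Convolution

/-! ### Partial derivatives of smooth functions -/

/-! A constant unit field on $B_R$ has no exchange energy, but its magnetostatic energy is
$|B_R|/3$, of order $R^3$. On a large ball a slowly varying tilt of the constant field does better:
it gains order $R^3$ in magnetostatic energy and costs only $o(R^3)$ in exchange.

Let $P$ be the orthogonal projection of $L^2$ fields onto the closure of gradients. The
demagnetizing field of $M$ is $-PM$, so the magnetostatic energy is $\|PM\|^2$
(`magnetostaticEnergy_eq`). Uniqueness of the demagnetizing field rests on a Liouville theorem for
square-integrable weakly harmonic functions. For uniform magnetization $c$ of a ball, $PM=c/3$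
inside (`gradProj_indicator_ball`).

The competitor is $n=(1-q)e_3+v$ with $v$ a small horizontal divergence-free field supported in
$B_1$ and $q=1-\sqrt{1-|v|^2}\le 1/3$ (`exists_tilt`). Since $Pv=0$, its energy on the ball is
$\|P(\chi e_3)-P(\chi q e_3)\|^2\le |B|/3-\tfrac23\int q+\int q^2\le |B|/3-\tfrac13\int q$
(`magnetostaticEnergy_tilt_le`).

For $n(x/R)$ the gain is $R^3\delta/3$ with $\delta=\int q>0$. The exchange energy is at most
$|B_R|\int j(z)\min\{4,K^2|z|^2/R^2\}\,dz$, whose integral tends to $0$ by (J2) and dominated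
convergence (`tendsto_exchangeBound`). -/

theorem contDiff_partialDeriv {φ : E3 → ℝ} (hφ : ContDiff ℝ ∞ φ) (i : Fin 3) :
    ContDiff ℝ ∞ (partialDeriv i φ) := by
  unfold partialDeriv
  exact (hφ.fderiv_right (m := ∞) (by simp)).clm_apply contDiff_const

theorem continuous_partialDeriv {φ : E3 → ℝ} (hφ : ContDiff ℝ ∞ φ) (i : Fin 3) :
    Continuous (partialDeriv i φ) :=
  (contDiff_partialDeriv hφ i).continuous

theorem hasCompactSupport_partialDeriv {φ : E3 → ℝ} (hφ : HasCompactSupport φ) (i : Fin 3) :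
    HasCompactSupport (partialDeriv i φ) :=
  (hφ.fderiv ℝ).comp_left (g := fun L : E3 →L[ℝ] ℝ => L (EuclideanSpace.single i 1)) (by simp)

theorem partialDeriv_comm {φ : E3 → ℝ} (hφ : ContDiff ℝ ∞ φ) (i j : Fin 3) (x : E3) :
    partialDeriv i (partialDeriv j φ) x = partialDeriv j (partialDeriv i φ) x := by
  have hd : DifferentiableAt ℝ (fderiv ℝ φ) x :=
    ((hφ.fderiv_right (m := ∞) (by simp)).differentiable (by simp)) x
  have key : ∀ a b : Fin 3, partialDeriv a (partialDeriv b φ) x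
      = fderiv ℝ (fderiv ℝ φ) x (EuclideanSpace.single a 1) (EuclideanSpace.single b 1) := by
    intro a b
    unfold partialDeriv
    rw [fderiv_clm_apply hd (differentiableAt_const _)]
    simp
  rw [key, key]
  exact (hφ.contDiffAt.isSymmSndFDerivAt (by simpa using WithTop.coe_le_coe.2 (le_top (a := (2 : ℕ∞))))) _ _

theorem partialDeriv_mul {f g : E3 → ℝ} (hf : Differentiable ℝ f) (hg : Differentiable ℝ g)
    (i : Fin 3) (x : E3) :
    partialDeriv i (fun y => f y * g y) x = partialDeriv i f x * g x + f x * partialDeriv i g x := by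
  unfold partialDeriv
  rw [fderiv_fun_mul (hf x) (hg x)]
  simp
  ring

theorem lineDeriv_eq_partialDeriv {φ : E3 → ℝ} (hφ : Differentiable ℝ φ) (i : Fin 3) (x : E3) :
    lineDeriv ℝ φ x (EuclideanSpace.single i 1) = partialDeriv i φ x :=
  (hφ x).lineDeriv_eq_fderiv

/-- Integration by parts against a compactly supported function. -/
theorem integral_partialDeriv_mul {f g : E3 → ℝ} (hf : ContDiff ℝ ∞ f) (hg : ContDiff ℝ ∞ g)
    (hgc : HasCompactSupport g) (i : Fin 3) :
    ∫ x, f x * partialDeriv i g x = - ∫ x, partialDeriv i f x * g x := by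
  refine integral_mul_fderiv_eq_neg_fderiv_mul_of_integrable ?_ ?_ ?_ ?_ ?_
  · exact ((continuous_partialDeriv hf i).mul hg.continuous).integrable_of_hasCompactSupport
      hgc.mul_left
  · exact (hf.continuous.mul (continuous_partialDeriv hg i)).integrable_of_hasCompactSupport
      (hasCompactSupport_partialDeriv hgc i).mul_left
  · exact (hf.continuous.mul hg.continuous).integrable_of_hasCompactSupport hgc.mul_left
  · exact fun x _ => (hf.differentiable (by simp)) x
  · exact fun x _ => (hg.differentiable (by simp)) x

/-! ### Square-integrable weakly harmonic functions vanish -/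

/-- The convolution of a test function with a locally integrable function. -/
noncomputable def mollify (ρ f : E3 → ℝ) : E3 → ℝ :=
  ρ ⋆[ContinuousLinearMap.lsmul ℝ ℝ, volume] f

theorem mollify_apply (ρ f : E3 → ℝ) (x : E3) : mollify ρ f x = ∫ y, ρ (x - y) * f y := by
  simp [mollify, convolution_eq_swap]

theorem contDiff_mollify {ρ f : E3 → ℝ} (hρ : ContDiff ℝ ∞ ρ) (hρc : HasCompactSupport ρ)
    (hf : LocallyIntegrable f volume) : ContDiff ℝ ∞ (mollify ρ f) :=
  hρc.contDiff_convolution_left _ hρ hf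

theorem partialDeriv_mollify {ρ f : E3 → ℝ} (hρ : ContDiff ℝ ∞ ρ) (hρc : HasCompactSupport ρ)
    (hf : LocallyIntegrable f volume) (i : Fin 3) :
    partialDeriv i (mollify ρ f) = mollify (partialDeriv i ρ) f := by
  ext x
  have h := hρc.hasFDerivAt_convolution_left (ContinuousLinearMap.lsmul ℝ ℝ) (μ := volume)
    (hρ.of_le (by simp)) hf x
  unfold partialDeriv mollify
  rw [h.fderiv]
  have hex := (hρc.fderiv ℝ).convolutionExists_left
    ((ContinuousLinearMap.lsmul ℝ ℝ).precompL E3 : (E3 →L[ℝ] ℝ) →L[ℝ] ℝ →L[ℝ] E3 →L[ℝ] ℝ)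
    (hρ.continuous_fderiv (by simp)) hf x
  rw [convolution_def, ContinuousLinearMap.integral_apply hex]
  rfl

theorem partialDeriv_comp_const_sub {ρ : E3 → ℝ} (i : Fin 3) (x y : E3) :
    partialDeriv i (fun z => ρ (x - z)) y = - partialDeriv i ρ (x - y) := by
  unfold partialDeriv
  by_cases h : DifferentiableAt ℝ ρ (x - y)
  · have := h.hasFDerivAt.comp y ((hasFDerivAt_id y).const_sub x)
    rw [show (fun z => ρ (x - z)) = ρ ∘ HSub.hSub x from rfl, this.fderiv]
    simp
  -- Reflection preserves nondifferentiability, so both derivatives take the default value 0 and no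
  -- smoothness is needed.
  · have h' : ¬ DifferentiableAt ℝ (fun z => ρ (x - z)) y := by
      intro hd
      apply h
      have hd' : DifferentiableAt ℝ (fun z => ρ (x - z)) (x - (x - y)) := by simpa using hd
      have := hd'.comp (x - y) ((differentiableAt_id (x := x - y)).const_sub x)
      refine this.congr_of_eventuallyEq (Eventually.of_forall fun z => ?_)
      simp
    rw [fderiv_zero_of_not_differentiableAt h, fderiv_zero_of_not_differentiableAt h']
    simp

/-- All derivatives fall on the kernel, and $y\mapsto\rho(x-y)$ is itself an admissible test
function. The two sign changes from the reflection cancel. -/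
theorem sum_partialDeriv_mollify_eq_zero {ρ f : E3 → ℝ} (hρ : ContDiff ℝ ∞ ρ)
    (hρc : HasCompactSupport ρ) (hf : LocallyIntegrable f volume)
    (hharm : ∀ φ : E3 → ℝ, ContDiff ℝ ∞ φ → HasCompactSupport φ →
      ∫ x, f x * ∑ i, partialDeriv i (partialDeriv i φ) x = 0) (x : E3) :
    ∑ i, partialDeriv i (partialDeriv i (mollify ρ f)) x = 0 := by
  have h1 : ∀ i, partialDeriv i (partialDeriv i (mollify ρ f)) x
      = ∫ y, partialDeriv i (partialDeriv i ρ) (x - y) * f y := by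
    intro i
    rw [partialDeriv_mollify hρ hρc hf, partialDeriv_mollify (contDiff_partialDeriv hρ i)
      (hasCompactSupport_partialDeriv hρc i) hf, mollify_apply]
  simp_rw [h1]
  have hsub : ∀ {g : E3 → ℝ}, HasCompactSupport g → HasCompactSupport (fun y => g (x - y)) :=
    fun hg => hg.comp_homeomorph (Homeomorph.subLeft x)
  rw [← integral_finsetSum]
  · have := hharm (fun y => ρ (x - y)) (hρ.comp (contDiff_const.sub contDiff_id)) (hsub hρc)
    rw [← this]
    congr 1
    ext y
    rw [← Finset.sum_mul, mul_comm]
    congr 1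
    refine Finset.sum_congr rfl fun i _ => ?_
    have : partialDeriv i (fun z => ρ (x - z)) = fun z => (fun z => - partialDeriv i ρ z) (x - z) := by
      ext z; exact partialDeriv_comp_const_sub i x z
    rw [this, partialDeriv_comp_const_sub (ρ := fun z => - partialDeriv i ρ z)]
    unfold partialDeriv
    rw [fderiv_fun_neg]
    simp
  · intro i _
    have hc := continuous_partialDeriv (contDiff_partialDeriv hρ i) i
    have hs := hasCompactSupport_partialDeriv (hasCompactSupport_partialDeriv hρc i) i
    have := hf.integrable_smul_left_of_hasCompactSupport (hc.comp (continuous_sub_left x)) (hsub hs)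
    simpa using this

/-- Jensen's inequality for the probability density $\rho(x-\cdot)$, obtained by expanding
$\int\rho(x-y)(f(y)-a)^2\,dy\ge0$ at the mean $a$. -/
theorem sq_mollify_le {ρ f : E3 → ℝ} (hρ : Continuous ρ) (hρc : HasCompactSupport ρ)
    (hρ0 : ∀ x, 0 ≤ ρ x) (hρ1 : ∫ x, ρ x = 1) (hf : MemLp f 2 volume) (x : E3) :
    mollify ρ f x ^ 2 ≤ mollify ρ (fun y => f y ^ 2) x := by
  rw [mollify_apply, mollify_apply]
  set a := ∫ y, ρ (x - y) * f y with ha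
  have hfl : LocallyIntegrable f volume := hf.locallyIntegrable (by norm_num)
  have hc : Continuous fun y => ρ (x - y) := hρ.comp (continuous_sub_left x)
  have hs : HasCompactSupport fun y => ρ (x - y) := hρc.comp_homeomorph (Homeomorph.subLeft x)
  have i1 : Integrable fun y => ρ (x - y) * f y := by
    simpa using hfl.integrable_smul_left_of_hasCompactSupport hc hs
  have i2 : Integrable fun y => ρ (x - y) * f y ^ 2 := by
    simpa using hf.integrable_sq.locallyIntegrable.integrable_smul_left_of_hasCompactSupport hc hs
  have i0 : Integrable fun y => ρ (x - y) := hc.integrable_of_hasCompactSupport hs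
  have e0 : ∫ y, ρ (x - y) = 1 := by rw [integral_sub_left_eq_self ρ, hρ1]
  have key : 0 ≤ ∫ y, (ρ (x - y) * f y ^ 2 - 2 * a * (ρ (x - y) * f y) + a ^ 2 * ρ (x - y)) := by
    refine integral_nonneg fun y => ?_
    have : ρ (x - y) * f y ^ 2 - 2 * a * (ρ (x - y) * f y) + a ^ 2 * ρ (x - y)
      = ρ (x - y) * (f y - a) ^ 2 := by ring
    simp only [Pi.zero_apply]
    rw [this]
    exact mul_nonneg (hρ0 _) (sq_nonneg _)
  rw [integral_add (f := fun y => ρ (x - y) * f y ^ 2 - 2 * a * (ρ (x - y) * f y))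
    (i2.sub (i1.const_mul _)) (i0.const_mul _), integral_sub i2 (i1.const_mul _),
    integral_const_mul, integral_const_mul, e0, ← ha] at key
  nlinarith

theorem integrable_sq_mollify {ρ f : E3 → ℝ} (hρ : ContDiff ℝ ∞ ρ) (hρc : HasCompactSupport ρ)
    (hρ0 : ∀ x, 0 ≤ ρ x) (hρ1 : ∫ x, ρ x = 1) (hf : MemLp f 2 volume) :
    Integrable fun x => mollify ρ f x ^ 2 := by
  have h := (hρ.continuous.integrable_of_hasCompactSupport hρc (μ := volume)).integrable_convolution
    (ContinuousLinearMap.lsmul ℝ ℝ) hf.integrable_sq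
  refine h.mono' ?_ (Eventually.of_forall fun x => ?_)
  · exact ((contDiff_mollify hρ hρc (hf.locallyIntegrable (by norm_num))).continuous.pow
      2).aestronglyMeasurable
  · rw [Real.norm_of_nonneg (sq_nonneg _)]
    exact sq_mollify_le hρ.continuous hρc hρ0 hρ1 hf x

theorem partialDeriv_comp_smul {η : E3 → ℝ} (c : ℝ) (i : Fin 3) (x : E3) :
    partialDeriv i (fun y => η (c • y)) x = c * partialDeriv i η (c • x) := by
  unfold partialDeriv
  rw [fderiv_comp_smul]
  simp

/-- Bernstein identity tested against a cutoff function. -/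
theorem integral_sum_sq_partialDeriv_mul {F η : E3 → ℝ} (hF : ContDiff ℝ ∞ F)
    (hharm : ∀ x, ∑ i, partialDeriv i (partialDeriv i F) x = 0)
    (hη : ContDiff ℝ ∞ η) (hηc : HasCompactSupport η) :
    ∫ x, (2 * ∑ i, partialDeriv i F x ^ 2) * η x
      = ∫ x, F x ^ 2 * ∑ i, partialDeriv i (partialDeriv i η) x := by
  have hFd := hF.differentiable (by simp)
  have hF2 : ContDiff ℝ ∞ fun x => F x * F x := hF.mul hF
  have d1 : ∀ i, partialDeriv i (fun x => F x * F x) = fun x => 2 * (F x * partialDeriv i F x) := by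
    intro i; ext x; rw [partialDeriv_mul hFd hFd]; ring
  have d2 : ∀ i x, partialDeriv i (partialDeriv i (fun x => F x * F x)) x
      = 2 * (partialDeriv i F x ^ 2 + F x * partialDeriv i (partialDeriv i F) x) := by
    intro i x
    rw [d1, partialDeriv_mul (f := fun _ => (2 : ℝ)) (g := fun x => F x * partialDeriv i F x)
      (differentiable_const _) (hFd.mul ((contDiff_partialDeriv hF i).differentiable (by simp))),
      partialDeriv_mul hFd ((contDiff_partialDeriv hF i).differentiable (by simp))]
    simp [partialDeriv]
    ring
  -- Two integrations by parts move the Laplacian from $\eta$ to $F^2$, and $\Delta(F^2)=2|\nabla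
  -- F|^2$ because $\Delta F=0$.
  have step : ∀ i, ∫ x, F x ^ 2 * partialDeriv i (partialDeriv i η) x
      = ∫ x, partialDeriv i (partialDeriv i (fun x => F x * F x)) x * η x := by
    intro i
    simp_rw [pow_two]
    rw [integral_partialDeriv_mul hF2 (contDiff_partialDeriv hη i)
      (hasCompactSupport_partialDeriv hηc i), integral_partialDeriv_mul
      (contDiff_partialDeriv hF2 i) hη hηc, neg_neg]
  simp_rw [Finset.mul_sum]
  rw [integral_finsetSum]
  · simp_rw [step]
    rw [← integral_finsetSum]
    · refine integral_congr_ae (Eventually.of_forall fun x => ?_)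
      simp only
      rw [← Finset.sum_mul]
      congr 1
      simp_rw [d2]
      simp_rw [mul_add, Finset.sum_add_distrib, ← Finset.mul_sum, hharm, mul_zero, add_zero]
    · intro i _
      exact ((continuous_partialDeriv (contDiff_partialDeriv hF2 i) i).mul
        hη.continuous).integrable_of_hasCompactSupport hηc.mul_left
  · intro i _
    exact ((hF.continuous.pow 2).mul
      (continuous_partialDeriv (contDiff_partialDeriv hη i) i)).integrable_of_hasCompactSupport
        (hasCompactSupport_partialDeriv (hasCompactSupport_partialDeriv hηc i) i).mul_left

theorem exists_cutoff : ∃ η : E3 → ℝ, ContDiff ℝ ∞ η ∧ HasCompactSupport η ∧ (∀ x, 0 ≤ η x) ∧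
    ∀ x ∈ closedBall (0 : E3) 1, η x = 1 := by
  let b : ContDiffBump (0 : E3) := ⟨1, 2, by norm_num, by norm_num⟩
  exact ⟨b, b.contDiff, b.hasCompactSupport, fun x => b.nonneg, fun x hx =>
    b.one_of_mem_closedBall hx⟩

/-- Liouville theorem: smooth square-integrable harmonic functions vanish. -/
theorem eq_zero_of_harmonic_of_integrable_sq {F : E3 → ℝ} (hF : ContDiff ℝ ∞ F)
    (hharm : ∀ x, ∑ i, partialDeriv i (partialDeriv i F) x = 0)
    (hint : Integrable fun x => F x ^ 2) : F = 0 := by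
  obtain ⟨η, hη, hηc, hη0, hη1⟩ := exists_cutoff
  have hLc : Continuous fun x => ∑ i, partialDeriv i (partialDeriv i η) x :=
    continuous_finsetSum _ fun i _ => continuous_partialDeriv (contDiff_partialDeriv hη i) i
  have hLs : ∀ i, HasCompactSupport (partialDeriv i (partialDeriv i η)) := fun i =>
    hasCompactSupport_partialDeriv (hasCompactSupport_partialDeriv hηc i) i
  have hb : ∀ i, ∃ C, ∀ x, ‖partialDeriv i (partialDeriv i η) x‖ ≤ C := fun i =>
    (continuous_partialDeriv (contDiff_partialDeriv hη i) i).bounded_above_of_compact_support (hLs i)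
  choose C hC using hb
  set D := ∑ i, C i with hD
  have hLb : ∀ x, ‖∑ i, partialDeriv i (partialDeriv i η) x‖ ≤ D := fun x =>
    (norm_sum_le _ _).trans (Finset.sum_le_sum fun i _ => hC i x)
  set G : E3 → ℝ := fun x => 2 * ∑ i, partialDeriv i F x ^ 2 with hG
  have hGc : Continuous G := continuous_const.mul
    (continuous_finsetSum _ fun i _ => (continuous_partialDeriv hF i).pow 2)
  have hG0 : ∀ x, 0 ≤ G x := fun x => by
    simp only [hG]; exact mul_nonneg (by norm_num) (Finset.sum_nonneg fun i _ => sq_nonneg _)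
  set K := (∫ x, F x ^ 2) * D with hK
  -- Testing with $\eta(x/R)$, whose Laplacian is $O(R^{-2})$, gives $2\int_{B_R}|\nabla F|^2\le
  -- R^{-2}K$. Letting $R\to\infty$ forces $\nabla F=0$.
  have bound : ∀ R : ℝ, 0 < R → ∫ x in closedBall (0 : E3) R, G x ≤ R⁻¹ ^ 2 * K := by
    intro R hR
    have hηR : ContDiff ℝ ∞ fun x => η (R⁻¹ • x) := hη.comp (contDiff_const_smul _)
    have hηRc : HasCompactSupport fun x => η (R⁻¹ • x) :=
      hηc.comp_homeomorph (Homeomorph.smulOfNeZero R⁻¹ (by positivity))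
    have hint1 : Integrable fun x => G x * η (R⁻¹ • x) :=
      (hGc.mul hηR.continuous).integrable_of_hasCompactSupport hηRc.mul_left
    calc ∫ x in closedBall (0 : E3) R, G x
        = ∫ x in closedBall (0 : E3) R, G x * η (R⁻¹ • x) := by
          refine setIntegral_congr_fun measurableSet_closedBall fun x hx => ?_
          have : η (R⁻¹ • x) = 1 := hη1 _ (by
            rw [mem_closedBall_zero_iff] at hx ⊢
            rw [norm_smul, norm_inv, Real.norm_of_nonneg hR.le, inv_mul_le_iff₀ hR]
            simpa using hx)
          simp [this]
      _ ≤ ∫ x, G x * η (R⁻¹ • x) :=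
          setIntegral_le_integral hint1 (Eventually.of_forall fun x => mul_nonneg (hG0 x) (hη0 _))
      _ = ∫ x, F x ^ 2 * ∑ i, partialDeriv i (partialDeriv i (fun y => η (R⁻¹ • y))) x :=
          integral_sum_sq_partialDeriv_mul hF hharm hηR hηRc
      _ ≤ ∫ x, R⁻¹ ^ 2 * (F x ^ 2 * D) := by
          have e : ∀ i x, partialDeriv i (partialDeriv i (fun y => η (R⁻¹ • y))) x
              = R⁻¹ ^ 2 * partialDeriv i (partialDeriv i η) (R⁻¹ • x) := by
            intro i x
            have : partialDeriv i (fun y => η (R⁻¹ • y))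
                = fun y => (fun z => R⁻¹ * partialDeriv i η z) (R⁻¹ • y) := by
              ext y; exact partialDeriv_comp_smul _ _ _
            rw [this, partialDeriv_comp_smul (η := fun z => R⁻¹ * partialDeriv i η z),
              partialDeriv_mul (f := fun _ => R⁻¹) (differentiable_const _)
                ((contDiff_partialDeriv hη i).differentiable (by simp))]
            simp [partialDeriv]
            ring
          have hle : ∀ x, F x ^ 2 * ∑ i, partialDeriv i (partialDeriv i (fun y => η (R⁻¹ • y))) x
              ≤ R⁻¹ ^ 2 * (F x ^ 2 * D) := by
            intro x
            simp_rw [e, ← Finset.mul_sum]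
            have h1 := (le_abs_self _).trans (hLb (R⁻¹ • x))
            have h2 := mul_le_mul_of_nonneg_left h1
              (mul_nonneg (sq_nonneg R⁻¹) (sq_nonneg (F x)))
            nlinarith
          refine integral_mono ?_ ((hint.mul_const D).const_mul _) hle
          simp_rw [Finset.mul_sum]
          refine integrable_finsetSum _ fun i _ => ?_
          exact ((hF.continuous.pow 2).mul
            (continuous_partialDeriv (contDiff_partialDeriv hηR i) i)).integrable_of_hasCompactSupport
            (hasCompactSupport_partialDeriv (hasCompactSupport_partialDeriv hηRc i) i).mul_left
      _ = R⁻¹ ^ 2 * K := by rw [integral_const_mul, integral_mul_const]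
  have hzero : ∀ x, G x = 0 := by
    intro x
    set r := ‖x‖ + 1 with hr
    have hr0 : 0 < r := by positivity
    have hle : ∫ y in closedBall (0 : E3) r, G y ≤ 0 := by
      have ht : Tendsto (fun R : ℝ => R⁻¹ ^ 2 * K) atTop (𝓝 0) := by
        simpa using (tendsto_inv_atTop_zero.pow 2).mul_const K
      refine ge_of_tendsto ht ?_
      filter_upwards [eventually_ge_atTop r] with R hR
      refine le_trans ?_ (bound R (hr0.trans_le hR))
      exact setIntegral_mono_set
        (hGc.continuousOn.integrableOn_compact (isCompact_closedBall _ _))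
        (Eventually.of_forall hG0) (closedBall_subset_closedBall hR).eventuallyLE
    have h0 := (setIntegral_eq_zero_iff_of_nonneg_ae (Eventually.of_forall hG0)
      (hGc.continuousOn.integrableOn_compact (isCompact_closedBall (0 : E3) r))).1
      (le_antisymm hle (integral_nonneg hG0))
    have h1 : G =ᵐ[volume.restrict (ball (0 : E3) r)] 0 :=
      ae_restrict_of_ae_restrict_of_subset ball_subset_closedBall h0
    exact Measure.eqOn_open_of_ae_eq h1 isOpen_ball hGc.continuousOn continuousOn_const
      (by rw [mem_ball_zero_iff]; linarith)
  have hp : ∀ i x, partialDeriv i F x = 0 := by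
    intro i x
    have h := hzero x
    simp only [hG, mul_eq_zero, OfNat.ofNat_ne_zero, false_or] at h
    have := (Finset.sum_eq_zero_iff_of_nonneg (fun i _ => sq_nonneg _)).1 h i (Finset.mem_univ i)
    exact pow_eq_zero_iff (two_ne_zero) |>.1 this
  have hd : ∀ x, fderiv ℝ F x = 0 := by
    intro x
    refine ContinuousLinearMap.coe_injective
      ((EuclideanSpace.basisFun (Fin 3) ℝ).toBasis.ext fun i => ?_)
    simpa [partialDeriv] using hp i x
  have hconst : ∀ x, F x = F 0 := fun x =>
    is_const_of_fderiv_eq_zero (hF.differentiable (by simp)) hd x 0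
  -- The space has infinite volume, so the only square-integrable constant is 0.
  have hi : Integrable (fun _ : E3 => F 0 ^ 2) := by simpa only [hconst] using hint
  rw [integrable_const_iff] at hi
  rcases hi with h | h
  · ext x
    rw [hconst x]
    exact pow_eq_zero_iff (two_ne_zero) |>.1 h
  · exact absurd (isFiniteMeasure_iff _ |>.1 h) (by simp)

/-- Each mollification of $f$ is smooth, harmonic and square-integrable, hence zero by Liouville,
while the mollifications converge almost everywhere to $f$. -/
theorem ae_eq_zero_of_weakly_harmonic {f : E3 → ℝ} (hf : MemLp f 2 volume)
    (hharm : ∀ φ : E3 → ℝ, ContDiff ℝ ∞ φ → HasCompactSupport φ →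
      ∫ x, f x * ∑ i, partialDeriv i (partialDeriv i φ) x = 0) : f =ᵐ[volume] 0 := by
  have hfl : LocallyIntegrable f volume := hf.locallyIntegrable (by norm_num)
  -- The radii shrink to 0 with a fixed ratio 2, as needed for almost everywhere convergence by
  -- Lebesgue differentiation.
  let b : ℕ → ContDiffBump (0 : E3) := fun n =>
    ⟨1 / ((n : ℝ) + 1), 2 * (1 / ((n : ℝ) + 1)), by positivity, by
      have : 0 < 1 / ((n : ℝ) + 1) := by positivity
      linarith⟩
  have hb : Tendsto (fun n => (b n).rOut) atTop (𝓝 0) := by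
    have := (tendsto_one_div_add_atTop_nhds_zero_nat (𝕜 := ℝ)).const_mul 2
    rwa [mul_zero] at this
  filter_upwards [ContDiffBump.ae_convolution_tendsto_right_of_locallyIntegrable hb
    (K := 2) (Eventually.of_forall fun n => le_rfl) hfl] with x hx
  have hz : ∀ n, mollify ((b n).normed volume) f = 0 := fun n =>
    eq_zero_of_harmonic_of_integrable_sq
      (contDiff_mollify (b n).contDiff_normed (b n).hasCompactSupport_normed hfl)
      (sum_partialDeriv_mollify_eq_zero (b n).contDiff_normed (b n).hasCompactSupport_normed hfl
        hharm)
      (integrable_sq_mollify (b n).contDiff_normed (b n).hasCompactSupport_normed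
        (fun x => (b n).nonneg_normed x) (b n).integral_normed hf)
  have : Tendsto (fun n => mollify ((b n).normed volume) f x) atTop (𝓝 (f x)) := hx
  simp only [hz, Pi.zero_apply] at this
  exact (tendsto_nhds_unique tendsto_const_nhds this).symm

/-! ### The demagnetizing field as an orthogonal projection -/

/-- Square-integrable vector fields on the whole space. -/
abbrev L2Field : Type := Lp E3 2 (volume : Measure E3)

/-- The gradient of a scalar function. -/
noncomputable def gradField (φ : E3 → ℝ) (x : E3) : E3 :=
  WithLp.toLp 2 fun i => partialDeriv i φ x

/-- The field dual to the `(i, j)` component of the weak curl tested against `φ`. -/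
noncomputable def curlField (i j : Fin 3) (φ : E3 → ℝ) (x : E3) : E3 :=
  partialDeriv i φ x • EuclideanSpace.single j 1 - partialDeriv j φ x • EuclideanSpace.single i 1

theorem memLp_gradField {φ : E3 → ℝ} (hφ : ContDiff ℝ ∞ φ) (hc : HasCompactSupport φ) :
    MemLp (gradField φ) 2 volume := by
  have hcont : Continuous (gradField φ) :=
    (PiLp.continuous_toLp 2 _).comp (continuous_pi fun i => continuous_partialDeriv hφ i)
  refine hcont.memLp_of_hasCompactSupport (HasCompactSupport.intro hc fun x hx => ?_)
  have : ∀ i, partialDeriv i φ x = 0 := fun i => by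
    unfold partialDeriv
    rw [fderiv_of_notMem_tsupport ℝ hx]
    simp
  ext i
  simp [gradField, this]

theorem memLp_curlField {φ : E3 → ℝ} (hφ : ContDiff ℝ ∞ φ) (hc : HasCompactSupport φ)
    (i j : Fin 3) : MemLp (curlField i j φ) 2 volume := by
  have hcont : Continuous (curlField i j φ) :=
    ((continuous_partialDeriv hφ i).smul continuous_const).sub
      ((continuous_partialDeriv hφ j).smul continuous_const)
  refine hcont.memLp_of_hasCompactSupport ?_
  exact (hasCompactSupport_partialDeriv hc i).smul_right.sub
    (hasCompactSupport_partialDeriv hc j).smul_right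

theorem inner_E3 (a b : E3) : inner ℝ a b = ∑ i, a i * b i := by
  simp [PiLp.inner_apply, mul_comm]

theorem inner_toLp {F G : E3 → E3} (hF : MemLp F 2 volume) (hG : MemLp G 2 volume) :
    inner ℝ (hF.toLp F) (hG.toLp G) = ∫ x, ∑ i, F x i * G x i := by
  rw [L2.inner_def]
  refine integral_congr_ae ?_
  filter_upwards [hF.coeFn_toLp, hG.coeFn_toLp] with x h1 h2
  rw [h1, h2, inner_E3]

theorem sum_mul_curlField (i j : Fin 3) (φ : E3 → ℝ) (v x : E3) :
    ∑ k, v k * curlField i j φ x k = v j * partialDeriv i φ x - v i * partialDeriv j φ x := by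
  simp [curlField, mul_sub, Finset.sum_sub_distrib]

/-! ### The weak equations as orthogonality relations in $L^2$ -/

theorem weaklyDivFree_iff {F : E3 → E3} (hF : MemLp F 2 volume) :
    WeaklyDivFree F ↔ ∀ (φ : E3 → ℝ) (hφ : ContDiff ℝ ∞ φ) (hc : HasCompactSupport φ),
      inner ℝ (hF.toLp F) ((memLp_gradField hφ hc).toLp _) = 0 := by
  simp_rw [inner_toLp hF]
  rfl

theorem weaklyCurlFree_iff {F : E3 → E3} (hF : MemLp F 2 volume) :
    WeaklyCurlFree F ↔ ∀ (φ : E3 → ℝ) (hφ : ContDiff ℝ ∞ φ) (hc : HasCompactSupport φ) (i j),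
      inner ℝ (hF.toLp F) ((memLp_curlField hφ hc i j).toLp _) = 0 := by
  simp_rw [inner_toLp hF, sum_mul_curlField]
  rfl

/-- The closure in `L²` of the gradients of test functions. -/
noncomputable def gradSpace : Submodule ℝ L2Field :=
  (Submodule.span ℝ {T | ∃ (φ : E3 → ℝ) (hφ : ContDiff ℝ ∞ φ) (hc : HasCompactSupport φ),
    T = (memLp_gradField hφ hc).toLp _}).topologicalClosure

instance : CompleteSpace gradSpace :=
  (Submodule.isClosed_topologicalClosure _).completeSpace_coe

theorem toLp_gradField_mem {φ : E3 → ℝ} (hφ : ContDiff ℝ ∞ φ) (hc : HasCompactSupport φ) :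
    (memLp_gradField hφ hc).toLp _ ∈ gradSpace :=
  Submodule.le_topologicalClosure _ (Submodule.subset_span ⟨φ, hφ, hc, rfl⟩)

theorem gradSpace_le_of_isClosed {S : Submodule ℝ L2Field} (hS : IsClosed (S : Set L2Field))
    (h : ∀ (φ : E3 → ℝ) (hφ : ContDiff ℝ ∞ φ) (hc : HasCompactSupport φ),
      (memLp_gradField hφ hc).toLp _ ∈ S) : gradSpace ≤ S :=
  Submodule.topologicalClosure_minimal _
    (Submodule.span_le.2 (by rintro T ⟨φ, hφ, hc, rfl⟩; exact h φ hφ hc)) hS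

theorem weaklyDivFree_iff_mem_orthogonal {F : E3 → E3} (hF : MemLp F 2 volume) :
    WeaklyDivFree F ↔ hF.toLp F ∈ gradSpaceᗮ := by
  rw [weaklyDivFree_iff hF]
  constructor
  · intro h
    rw [Submodule.mem_orthogonal']
    intro T hT
    have hle : gradSpace ≤ (Submodule.span ℝ {hF.toLp F})ᗮ :=
      gradSpace_le_of_isClosed (Submodule.isClosed_orthogonal _) fun φ hφ hc =>
        Submodule.mem_orthogonal_singleton_iff_inner_right.2 (h φ hφ hc)
    exact Submodule.mem_orthogonal_singleton_iff_inner_right.1 (hle hT)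
  · intro h φ hφ hc
    exact (Submodule.mem_orthogonal' _ _).1 h _ (toLp_gradField_mem hφ hc)

theorem integral_partialDeriv_mul_partialDeriv_comm {f φ : E3 → ℝ} (hf : ContDiff ℝ ∞ f)
    (hφ : ContDiff ℝ ∞ φ) (hc : HasCompactSupport φ) (i j : Fin 3) :
    ∫ x, partialDeriv i f x * partialDeriv j φ x = ∫ x, partialDeriv j f x * partialDeriv i φ x := by
  have h : ∀ a b : Fin 3, ∫ x, partialDeriv a f x * partialDeriv b φ x
      = - ∫ x, f x * partialDeriv a (partialDeriv b φ) x := fun a b => by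
    rw [integral_partialDeriv_mul hf (contDiff_partialDeriv hφ b)
      (hasCompactSupport_partialDeriv hc b), neg_neg]
  rw [h, h]
  simp_rw [partialDeriv_comm hφ i j]

theorem integrable_partialDeriv_mul_partialDeriv {f φ : E3 → ℝ} (hf : ContDiff ℝ ∞ f)
    (hφ : ContDiff ℝ ∞ φ) (hc : HasCompactSupport φ) (i j : Fin 3) :
    Integrable fun x => partialDeriv i f x * partialDeriv j φ x :=
  ((continuous_partialDeriv hf i).mul
    (continuous_partialDeriv hφ j)).integrable_of_hasCompactSupport
      (hasCompactSupport_partialDeriv hc j).mul_left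

/-- Second derivatives of the test function commute. No decay of $f$ is required, which later allows
field and test function to exchange roles. -/
theorem weaklyCurlFree_gradField {f : E3 → ℝ} (hf : ContDiff ℝ ∞ f) :
    WeaklyCurlFree (gradField f) := by
  intro φ hφ hc i j
  simp only [gradField]
  rw [integral_sub (integrable_partialDeriv_mul_partialDeriv hf hφ hc _ _)
    (integrable_partialDeriv_mul_partialDeriv hf hφ hc _ _),
    integral_partialDeriv_mul_partialDeriv_comm hf hφ hc j i, sub_self]

theorem weaklyCurlFree_of_mem_gradSpace {F : E3 → E3} (hF : MemLp F 2 volume)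
    (h : hF.toLp F ∈ gradSpace) : WeaklyCurlFree F := by
  rw [weaklyCurlFree_iff hF]
  intro φ hφ hc i j
  have hle : gradSpace ≤ (Submodule.span ℝ {(memLp_curlField hφ hc i j).toLp _})ᗮ :=
    gradSpace_le_of_isClosed (Submodule.isClosed_orthogonal _) fun ψ hψ hψc =>
      Submodule.mem_orthogonal_singleton_iff_inner_left.2
        ((weaklyCurlFree_iff (memLp_gradField hψ hψc)).1 (weaklyCurlFree_gradField hψ) φ hφ hc i j)
  exact Submodule.mem_orthogonal_singleton_iff_inner_left.1 (hle h)

/-- A square-integrable field that is weakly divergence free and curl free vanishes. -/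
theorem ae_eq_zero_of_weaklyDivFree_of_weaklyCurlFree {F : E3 → E3} (hF : MemLp F 2 volume)
    (hdiv : WeaklyDivFree F) (hcurl : WeaklyCurlFree F) : F =ᵐ[volume] 0 := by
  have hFi : ∀ i, MemLp (fun x => F x i) 2 volume := fun i =>
    (EuclideanSpace.proj (𝕜 := ℝ) i : E3 →L[ℝ] ℝ).comp_memLp' hF
  have hloc : ∀ i, LocallyIntegrable (fun x => F x i) volume := fun i =>
    (hFi i).locallyIntegrable (by norm_num)
  have hint : ∀ {g : E3 → ℝ} (_ : ContDiff ℝ ∞ g) (_ : HasCompactSupport g) (i j k : Fin 3),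
      Integrable fun x => F x k * partialDeriv i (partialDeriv j g) x := by
    intro g hg hgc i j k
    simpa [mul_comm] using (hloc k).integrable_smul_left_of_hasCompactSupport
      (continuous_partialDeriv (contDiff_partialDeriv hg j) i)
      (hasCompactSupport_partialDeriv (hasCompactSupport_partialDeriv hgc j) i)
  have hcomp : ∀ i, (fun x => F x i) =ᵐ[volume] 0 := by
    intro i
    refine ae_eq_zero_of_weakly_harmonic (hFi i) fun φ hφ hc => ?_
    have h1 := hdiv (partialDeriv i φ) (contDiff_partialDeriv hφ i)
      (hasCompactSupport_partialDeriv hc i)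
    -- Vanishing curl, tested with $\partial_j\varphi$, replaces $F_i\,\partial_j\partial_j\varphi$
    -- by $F_j\,\partial_j\partial_i\varphi$. The sum over $j$ is then the divergence of $F$ tested
    -- with $\partial_i\varphi$, so each component is weakly harmonic.
    have h2 : ∀ j, ∫ x, F x i * partialDeriv j (partialDeriv j φ) x
        = ∫ x, F x j * partialDeriv j (partialDeriv i φ) x := by
      intro j
      have := hcurl (partialDeriv j φ) (contDiff_partialDeriv hφ j)
        (hasCompactSupport_partialDeriv hc j) j i
      rw [integral_sub (hint hφ hc _ _ _) (hint hφ hc _ _ _), sub_eq_zero] at this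
      rw [this]
      simp_rw [partialDeriv_comm hφ i j]
    simp_rw [Finset.mul_sum]
    rw [integral_finsetSum _ fun j _ => hint hφ hc _ _ _]
    simp_rw [h2]
    rw [← integral_finsetSum _ fun j _ => hint hφ hc j i j]
    exact h1
  filter_upwards [ae_all_iff.2 hcomp] with x hx
  ext i
  exact hx i

/-- Uniqueness makes the choice in `demagField` harmless: any explicit solution may be used to
compute the energy. -/
theorem IsDemagField.ae_eq {M h₁ h₂ : E3 → E3} (hM : MemLp M 2 volume) (H₁ : IsDemagField M h₁)
    (H₂ : IsDemagField M h₂) : h₁ =ᵐ[volume] h₂ := by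
  have hs := H₁.memLp.sub H₂.memLp
  have hdiv : WeaklyDivFree (h₁ - h₂) := by
    have d1 := (weaklyDivFree_iff_mem_orthogonal (hM.add H₁.memLp)).1 H₁.div_eq
    have d2 := (weaklyDivFree_iff_mem_orthogonal (hM.add H₂.memLp)).1 H₂.div_eq
    rw [weaklyDivFree_iff_mem_orthogonal hs]
    have := Submodule.sub_mem _ d1 d2
    rw [MemLp.toLp_add hM H₁.memLp, MemLp.toLp_add hM H₂.memLp, add_sub_add_left_eq_sub] at this
    rwa [MemLp.toLp_sub H₁.memLp H₂.memLp]
  have hcurl : WeaklyCurlFree (h₁ - h₂) := by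
    rw [weaklyCurlFree_iff hs]
    intro φ hφ hc i j
    rw [MemLp.toLp_sub H₁.memLp H₂.memLp, inner_sub_left,
      (weaklyCurlFree_iff H₁.memLp).1 H₁.curl_eq φ hφ hc i j,
      (weaklyCurlFree_iff H₂.memLp).1 H₂.curl_eq φ hφ hc i j, sub_zero]
  filter_upwards [ae_eq_zero_of_weaklyDivFree_of_weaklyCurlFree hs hdiv hcurl] with x hx
  simpa [sub_eq_zero] using hx

/-- The orthogonal projection of `L²` fields onto the closure of gradients. -/
noncomputable def gradProj : L2Field →L[ℝ] L2Field :=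
  gradSpace.starProjection

theorem inner_gradProj_left (F G : L2Field) :
    inner ℝ (gradProj F) G = inner ℝ F (gradProj G) :=
  Submodule.inner_starProjection_left_eq_right _ _ _

theorem gradProj_gradProj (F : L2Field) : gradProj (gradProj F) = gradProj F :=
  Submodule.starProjection_eq_self_iff.2 (Submodule.starProjection_apply_mem _ _)

theorem norm_gradProj_le (F : L2Field) : ‖gradProj F‖ ≤ ‖F‖ :=
  Submodule.norm_starProjection_apply_le _ _

theorem inner_gradProj_self (F : L2Field) : inner ℝ (gradProj F) F = ‖gradProj F‖ ^ 2 := by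
  rw [← real_inner_self_eq_norm_sq, inner_gradProj_left, inner_gradProj_left, gradProj_gradProj]

/-- Helmholtz decomposition: $M-PM$ is orthogonal to gradients, hence divergence free, and $-PM$ is
a limit of gradients, hence curl free. -/
theorem isDemagField_neg_gradProj {M : E3 → E3} (hM : MemLp M 2 volume) :
    IsDemagField M (-gradProj (hM.toLp M) : L2Field) := by
  have hp := Lp.memLp (-gradProj (hM.toLp M))
  refine ⟨hp, ?_, ?_⟩
  · refine (weaklyDivFree_iff_mem_orthogonal (hM.add hp)).2 ?_
    rw [MemLp.toLp_add hM hp, Lp.toLp_coeFn, ← sub_eq_add_neg]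
    exact Submodule.sub_starProjection_mem_orthogonal _
  · refine weaklyCurlFree_of_mem_gradSpace hp ?_
    rw [Lp.toLp_coeFn]
    exact Submodule.neg_mem _ (Submodule.starProjection_apply_mem _ _)

theorem IsDemagField.toLp_eq {M h : E3 → E3} (hM : MemLp M 2 volume) (H : IsDemagField M h) :
    H.memLp.toLp h = -gradProj (hM.toLp M) := by
  rw [← Lp.toLp_coeFn (-gradProj (hM.toLp M)) (Lp.memLp _)]
  exact (MemLp.toLp_eq_toLp_iff _ _).2 (H.ae_eq hM (isDemagField_neg_gradProj hM))

theorem isDemagField_demagField {M : E3 → E3} (hM : MemLp M 2 volume) :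
    IsDemagField M (demagField M) :=
  Classical.epsilon_spec (p := IsDemagField M) ⟨_, isDemagField_neg_gradProj hM⟩

theorem magnetostaticEnergy_eq {Ω : Set E3} (hΩ : MeasurableSet Ω) {m : E3 → E3}
    (hm : MemLp (Ω.indicator m) 2 volume) :
    magnetostaticEnergy Ω m = ‖gradProj (hm.toLp _)‖ ^ 2 := by
  have H := isDemagField_demagField hm
  have : inner ℝ (H.memLp.toLp _) (hm.toLp _) = ∫ x in Ω, inner ℝ (demagField (Ω.indicator m) x) (m x) := by
    rw [inner_toLp, ← integral_indicator hΩ]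
    congr 1
    ext x
    by_cases hx : x ∈ Ω <;> simp [hx, inner_E3]
  rw [magnetostaticEnergy, ← this, H.toLp_eq hm, inner_neg_left, neg_neg, inner_gradProj_self]

theorem gradProj_eq_zero_of_weaklyDivFree {F : E3 → E3} (hF : MemLp F 2 volume)
    (h : WeaklyDivFree F) : gradProj (hF.toLp F) = 0 :=
  Submodule.starProjection_apply_eq_zero_iff _ |>.2 ((weaklyDivFree_iff_mem_orthogonal hF).1 h)

/-! ### The field of a uniformly magnetized ball -/

/-- The `k`-th component of the gradient of the Newtonian potential of the ball of radius `R`. -/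
noncomputable def ballPotential (R : ℝ) (k : Fin 3) (x : E3) : ℝ :=
  x k / 3 * (R / max R ‖x‖) ^ 3

/-- The constant 4 splits as 1 for the rescaled difference $x-y$ and 3 for the change of the radial
factor, through $1-\tau^3\le3(1-\tau)$. Lipschitz continuity across the sphere $|x|=R$ later permits
integration by parts without surface terms. -/
theorem norm_radial_sub_le {R : ℝ} (hR : 0 < R) {x y : E3} (hxy : ‖x‖ ≤ ‖y‖) :
    ‖(R / max R ‖x‖) ^ 3 • x - (R / max R ‖y‖) ^ 3 • y‖ ≤ 4 * ‖x - y‖ := by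
  set r := max R ‖x‖ with hr
  set s := max R ‖y‖ with hs
  have hrR : R ≤ r := le_max_left _ _
  have hxr : ‖x‖ ≤ r := le_max_right _ _
  have hrs : r ≤ s := max_le_max le_rfl hxy
  have hr0 : 0 < r := hR.trans_le hrR
  have hs0 : 0 < s := hr0.trans_le hrs
  have hsr : s - r ≤ ‖x - y‖ := by
    have h1 : s ≤ r + (‖y‖ - ‖x‖) := by
      refine max_le (by linarith) (by linarith)
    have h2 := norm_sub_norm_le y x
    rw [norm_sub_rev] at h2
    linarith
  set p := R / r with hp
  set τ := r / s with hτ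
  have hp0 : 0 ≤ p := by positivity
  have hp1 : p ≤ 1 := (div_le_one hr0).2 hrR
  have hτ0 : 0 ≤ τ := by positivity
  have hτ1 : τ ≤ 1 := (div_le_one hs0).2 hrs
  have hq : R / s = p * τ := by rw [hp, hτ]; field_simp
  have hp3 : p ^ 3 ≤ 1 := pow_le_one₀ hp0 hp1
  have hτ3 : τ ^ 3 ≤ 1 := pow_le_one₀ hτ0 hτ1
  have hcube : 1 - τ ^ 3 ≤ 3 * (1 - τ) := by nlinarith [mul_nonneg hτ0 (sub_nonneg.2 hτ1)]
  have e : (p ^ 3 • x - (p * τ) ^ 3 • y : E3)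
      = (p * τ) ^ 3 • (x - y) + (p ^ 3 * (1 - τ ^ 3)) • x := by
    module
  rw [hq, e]
  refine (norm_add_le _ _).trans ?_
  rw [norm_smul, norm_smul, Real.norm_of_nonneg (by positivity),
    Real.norm_of_nonneg (mul_nonneg (by positivity) (by linarith))]
  have h1 : (p * τ) ^ 3 * ‖x - y‖ ≤ ‖x - y‖ := by
    refine mul_le_of_le_one_left (norm_nonneg _) ?_
    exact pow_le_one₀ (by positivity) (mul_le_one₀ hp1 hτ0 hτ1)
  have h2 : p ^ 3 * (1 - τ ^ 3) * ‖x‖ ≤ 3 * (1 - τ) * r := by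
    have : p ^ 3 * (1 - τ ^ 3) ≤ 3 * (1 - τ) :=
      (mul_le_of_le_one_left (by linarith) hp3).trans hcube
    exact mul_le_mul this hxr (norm_nonneg _) (by linarith)
  have h3 : (1 - τ) * r ≤ s - r := by
    have : (1 - τ) * s = s - r := by rw [hτ]; field_simp
    rw [← this]
    exact mul_le_mul_of_nonneg_left hrs (by linarith)
  linarith

theorem lipschitzWith_ballPotential {R : ℝ} (hR : 0 < R) (k : Fin 3) :
    LipschitzWith 4 (ballPotential R k) := by
  have hle : ∀ x y : E3, ‖x‖ ≤ ‖y‖ → |ballPotential R k x - ballPotential R k y| ≤ 4 * ‖x - y‖ := by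
    intro x y hxy
    have h1 := norm_radial_sub_le hR hxy
    have h2 := PiLp.norm_apply_le ((R / max R ‖x‖) ^ 3 • x - (R / max R ‖y‖) ^ 3 • y) k
    have h3 : ballPotential R k x - ballPotential R k y
        = (((R / max R ‖x‖) ^ 3 • x - (R / max R ‖y‖) ^ 3 • y : E3) k) / 3 := by
      simp [ballPotential]
      ring
    rw [Real.norm_eq_abs] at h2
    rw [h3, abs_div, abs_of_pos (by norm_num : (0 : ℝ) < 3)]
    have := abs_nonneg (((R / max R ‖x‖) ^ 3 • x - (R / max R ‖y‖) ^ 3 • y : E3) k)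
    linarith
  refine LipschitzWith.of_dist_le_mul fun x y => ?_
  rw [Real.dist_eq, dist_eq_norm]
  rcases le_total ‖x‖ ‖y‖ with h | h
  · exact_mod_cast hle x y h
  · rw [abs_sub_comm, norm_sub_rev]
    exact_mod_cast hle y x h

/-- The derivative of the `k`-th component of the ball potential gradient in direction `i`. -/
noncomputable def ballHessian (R : ℝ) (i k : Fin 3) (x : E3) : ℝ :=
  lineDeriv ℝ (ballPotential R k) x (EuclideanSpace.single i 1)

theorem ballHessian_of_norm_lt {R : ℝ} {x : E3} (hx : ‖x‖ < R) (i k : Fin 3) :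
    ballHessian R i k x = if i = k then 1 / 3 else 0 := by
  have h : ballPotential R k =ᶠ[𝓝 x] fun y => (EuclideanSpace.proj (𝕜 := ℝ) k : E3 →L[ℝ] ℝ) y / 3 := by
    filter_upwards [(isOpen_lt continuous_norm continuous_const).mem_nhds hx] with y hy
    have hy' : ‖y‖ < R := hy
    have hR : R ≠ 0 := ((norm_nonneg y).trans_lt hy').ne'
    simp [ballPotential, max_eq_left hy'.le, div_self hR]
  have h2 : HasFDerivAt (fun y : E3 => (EuclideanSpace.proj (𝕜 := ℝ) k : E3 →L[ℝ] ℝ) y / 3)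
      ((3 : ℝ)⁻¹ • (EuclideanSpace.proj (𝕜 := ℝ) k : E3 →L[ℝ] ℝ)) x := by
    simp_rw [div_eq_inv_mul]
    exact (EuclideanSpace.proj (𝕜 := ℝ) k : E3 →L[ℝ] ℝ).hasFDerivAt.const_smul (3 : ℝ)⁻¹
  rw [ballHessian, h.lineDeriv_eq, (h2.hasLineDerivAt _).lineDeriv]
  by_cases hik : i = k <;> simp [hik, Ne.symm]

theorem ballHessian_of_lt_norm {R : ℝ} (hR : 0 < R) {x : E3} (hx : R < ‖x‖) (i k : Fin 3) :
    ballHessian R i k x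
      = R ^ 3 / 3 * ((if i = k then 1 else 0) / ‖x‖ ^ 3 - 3 * (x i * x k) / ‖x‖ ^ 5) := by
  have hx0 : 0 < ‖x‖ := hR.trans hx
  have h : ballPotential R k =ᶠ[𝓝 x] fun y => y k / 3 * (R / ‖y‖) ^ 3 := by
    filter_upwards [(isOpen_lt continuous_const continuous_norm).mem_nhds hx] with y hy
    have hy' : R < ‖y‖ := hy
    simp [ballPotential, max_eq_right hy'.le]
  rw [ballHessian, h.lineDeriv_eq]
  set v : E3 := EuclideanSpace.single i 1 with hv
  have hline : HasDerivAt (fun t : ℝ => x + t • v) v 0 := by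
    simpa using ((hasDerivAt_id (0 : ℝ)).smul_const v).const_add x
  have hinner : inner ℝ x v = x i := by simp [hv, inner_E3]
  have hsq : HasDerivAt (fun t : ℝ => ‖x + t • v‖ ^ 2) (2 * x i) 0 := by
    simpa [hinner] using hline.norm_sq
  have hn : HasDerivAt (fun t : ℝ => ‖x + t • v‖) (x i / ‖x‖) 0 := by
    have := hsq.sqrt (by simpa using hx0.ne')
    simp only [Real.sqrt_sq (norm_nonneg _), zero_smul, add_zero] at this
    convert this using 1
    field_simp
  have hk : HasDerivAt (fun t : ℝ => (x + t • v) k) (v k) 0 :=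
    (EuclideanSpace.proj (𝕜 := ℝ) k : E3 →L[ℝ] ℝ).hasFDerivAt.comp_hasDerivAt 0 hline
  have hvk : v k = if i = k then 1 else 0 := by
    by_cases hik : i = k <;> simp [hv, hik, eq_comm]
  have hall := (hk.div_const 3).mul (((hasDerivAt_const (0 : ℝ) R).div hn (by simpa using hx0.ne')).pow 3)
  rw [lineDeriv, ← hvk]
  refine (hall.congr_deriv ?_).deriv
  simp
  field_simp
  ring

theorem ballHessian_symm {R : ℝ} (hR : 0 < R) {x : E3} (hx : ‖x‖ ≠ R) (i k : Fin 3) :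
    ballHessian R i k x = ballHessian R k i x := by
  rcases lt_or_gt_of_ne hx with h | h
  · simp_rw [ballHessian_of_norm_lt h, eq_comm]
  · simp_rw [ballHessian_of_lt_norm hR h, eq_comm (a := i), mul_comm (x i)]

/-- Poisson's equation for the ball: the trace is $3\cdot\frac13$ inside, and outside the dipole
field $x/|x|^3$ is divergence free. -/
theorem sum_ballHessian {R : ℝ} (hR : 0 < R) {x : E3} (hx : ‖x‖ ≠ R) :
    ∑ k, ballHessian R k k x = (ball (0 : E3) R).indicator 1 x := by
  rcases lt_or_gt_of_ne hx with h | h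
  · simp [ballHessian_of_norm_lt h, Set.indicator, h]
  · have hx0 : 0 < ‖x‖ := hR.trans h
    have hsum : x 0 ^ 2 + x 1 ^ 2 + x 2 ^ 2 = ‖x‖ ^ 2 := by
      rw [EuclideanSpace.real_norm_sq_eq, Fin.sum_univ_three]
    simp only [ballHessian_of_lt_norm hR h, if_true, Fin.sum_univ_three]
    rw [Set.indicator_of_notMem (by simpa using h.le)]
    have : (1 : ℝ) / ‖x‖ ^ 3 = ‖x‖ ^ 2 / ‖x‖ ^ 5 := by field_simp
    rw [this, ← hsum]
    ring

/-- The decay $|x|^{-3}$ gives square integrability, since $6>3$. -/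
theorem abs_ballHessian_le {R : ℝ} (hR : 0 < R) {x : E3} (hx : ‖x‖ ≠ R) (i k : Fin 3) :
    |ballHessian R i k x| ≤ 2 * (1 + R) ^ 3 * ((1 + ‖x‖) ^ 3)⁻¹ := by
  rw [← div_eq_mul_inv, le_div_iff₀ (by positivity)]
  rcases lt_or_gt_of_ne hx with h | h
  · rw [ballHessian_of_norm_lt h]
    have h1 : |(if i = k then 1 / 3 else 0 : ℝ)| ≤ 2 := by
      split_ifs <;> norm_num [abs_of_pos]
    have h2 : (1 + ‖x‖) ^ 3 ≤ (1 + R) ^ 3 := by gcongr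
    exact mul_le_mul h1 h2 (by positivity) (by norm_num)
  · have hx0 : 0 < ‖x‖ := hR.trans h
    rw [ballHessian_of_lt_norm hR h]
    have hxi : ∀ i, |x i| ≤ ‖x‖ := fun i => by simpa using PiLp.norm_apply_le x i
    have h1 : |(if i = k then 1 else 0) / ‖x‖ ^ 3 - 3 * (x i * x k) / ‖x‖ ^ 5| ≤ 4 / ‖x‖ ^ 3 := by
      have a1 : |(if i = k then 1 else 0 : ℝ) / ‖x‖ ^ 3| ≤ 1 / ‖x‖ ^ 3 := by
        rw [abs_div, abs_of_pos (by positivity : 0 < ‖x‖ ^ 3)]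
        gcongr
        split_ifs <;> simp
      have a2 : |3 * (x i * x k) / ‖x‖ ^ 5| ≤ 3 / ‖x‖ ^ 3 := by
        rw [abs_div, abs_of_pos (by positivity : 0 < ‖x‖ ^ 5), abs_mul, abs_mul,
          div_le_div_iff₀ (by positivity) (by positivity), abs_of_pos (by norm_num : (0 : ℝ) < 3)]
        have := mul_le_mul (hxi i) (hxi k) (abs_nonneg _) (norm_nonneg _)
        calc 3 * (|x i| * |x k|) * ‖x‖ ^ 3 ≤ 3 * (‖x‖ * ‖x‖) * ‖x‖ ^ 3 := by gcongr
          _ = 3 * ‖x‖ ^ 5 := by ring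
      calc _ ≤ _ := abs_sub _ _
        _ ≤ 1 / ‖x‖ ^ 3 + 3 / ‖x‖ ^ 3 := add_le_add a1 a2
        _ = 4 / ‖x‖ ^ 3 := by ring
    rw [abs_mul, abs_of_pos (by positivity : 0 < R ^ 3 / 3)]
    have h3 : R * (1 + ‖x‖) ≤ (1 + R) * ‖x‖ := by nlinarith
    calc R ^ 3 / 3 * |(if i = k then 1 else 0) / ‖x‖ ^ 3 - 3 * (x i * x k) / ‖x‖ ^ 5| * (1 + ‖x‖) ^ 3
        ≤ R ^ 3 / 3 * (4 / ‖x‖ ^ 3) * (1 + ‖x‖) ^ 3 := by gcongr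
      _ = 4 / 3 * (R * (1 + ‖x‖)) ^ 3 / ‖x‖ ^ 3 := by ring
      _ ≤ 4 / 3 * ((1 + R) * ‖x‖) ^ 3 / ‖x‖ ^ 3 := by gcongr
      _ = 4 / 3 * (1 + R) ^ 3 := by field_simp
      _ ≤ 2 * (1 + R) ^ 3 := by gcongr; norm_num

theorem ae_norm_ne (R : ℝ) : ∀ᵐ x : E3, ‖x‖ ≠ R := by
  have := Measure.addHaar_sphere (volume : Measure E3) 0 R
  filter_upwards [measure_eq_zero_iff_ae_notMem.1 this] with x hx
  simpa using hx

theorem measurable_ballHessian {R : ℝ} (hR : 0 < R) (i k : Fin 3) :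
    Measurable (ballHessian R i k) :=
  measurable_lineDeriv (lipschitzWith_ballPotential hR k).continuous

theorem memLp_ballHessian {R : ℝ} (hR : 0 < R) (i k : Fin 3) :
    MemLp (ballHessian R i k) 2 volume := by
  have hint : Integrable fun x : E3 => (1 + ‖x‖) ^ (-6 : ℝ) :=
    integrable_one_add_norm (by simp; norm_num)
  rw [memLp_two_iff_integrable_sq (measurable_ballHessian hR i k).aestronglyMeasurable]
  refine (hint.const_mul ((2 * (1 + R) ^ 3) ^ 2)).mono'
    ((measurable_ballHessian hR i k).pow_const 2).aestronglyMeasurable ?_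
  filter_upwards [ae_norm_ne R] with x hx
  have h := abs_ballHessian_le hR hx i k
  rw [Real.norm_of_nonneg (sq_nonneg _), ← sq_abs]
  refine (pow_le_pow_left₀ (abs_nonneg _) h 2).trans (le_of_eq ?_)
  rw [mul_pow, Real.rpow_neg (by positivity)]
  congr 1
  rw [inv_pow, ← pow_mul]
  norm_cast

/-- Mixed derivatives commute weakly for Lipschitz functions. -/
theorem integral_lineDeriv_mul_partialDeriv_comm {C : NNReal} {f φ : E3 → ℝ}
    (hf : LipschitzWith C f) (hφ : ContDiff ℝ ∞ φ) (hc : HasCompactSupport φ) (i j : Fin 3) :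
    ∫ x, lineDeriv ℝ f x (EuclideanSpace.single i 1) * partialDeriv j φ x
      = ∫ x, lineDeriv ℝ f x (EuclideanSpace.single j 1) * partialDeriv i φ x := by
  have key : ∀ a b : Fin 3, ∫ x, lineDeriv ℝ f x (EuclideanSpace.single a 1) * partialDeriv b φ x
      = ∫ x, - partialDeriv a (partialDeriv b φ) x * f x := by
    intro a b
    have hs := contDiff_partialDeriv hφ b
    obtain ⟨D, hD⟩ := (hs.of_le (m := 1) (by simp)).lipschitzWith_of_hasCompactSupport
      (hasCompactSupport_partialDeriv hc b) (by simp)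
    rw [hf.integral_lineDeriv_mul_eq hD (hasCompactSupport_partialDeriv hc b)]
    congr 1
    ext x
    rw [lineDeriv_neg, lineDeriv_eq_partialDeriv (hs.differentiable (by simp))]
  rw [key, key]
  simp_rw [partialDeriv_comm hφ i j]

/-- The field whose components are the derivatives of the `a`-th component of the ball potential
gradient. -/
noncomputable def ballField (R : ℝ) (a : Fin 3) (x : E3) : E3 :=
  WithLp.toLp 2 fun i => ballHessian R i a x

theorem memLp_ballField {R : ℝ} (hR : 0 < R) (a : Fin 3) : MemLp (ballField R a) 2 volume :=
  MemLp.of_eval_piLp fun i => memLp_ballHessian hR i a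

theorem memLp_indicator_ball {f : E3 → E3} (hf : Continuous f) (R : ℝ) :
    MemLp ((ball (0 : E3) R).indicator f) 2 volume := by
  rw [memLp_indicator_iff_restrict measurableSet_ball]
  obtain ⟨C, hC⟩ := (isCompact_closedBall (0 : E3) R).exists_bound_of_continuousOn hf.continuousOn
  have : IsFiniteMeasure (volume.restrict (ball (0 : E3) R)) :=
    ⟨by simpa using measure_ball_lt_top (μ := (volume : Measure E3)) (x := 0) (r := R)⟩
  refine MemLp.of_bound hf.aestronglyMeasurable C ?_
  filter_upwards [ae_restrict_mem measurableSet_ball] with x hx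
  exact hC x (ball_subset_closedBall hx)

theorem integrable_ballHessian_mul {R : ℝ} (hR : 0 < R) {φ : E3 → ℝ} (hφ : ContDiff ℝ ∞ φ)
    (hc : HasCompactSupport φ) (i k j : Fin 3) :
    Integrable fun x => ballHessian R i k x * partialDeriv j φ x := by
  simpa [mul_comm] using ((memLp_ballHessian hR i k).locallyIntegrable
    (by norm_num)).integrable_smul_left_of_hasCompactSupport (continuous_partialDeriv hφ j)
      (hasCompactSupport_partialDeriv hc j)

/-- Write $w_k$ for `ballPotential R k`. The field is $-\nabla w_a$, hence curl free. Since
$\chi=\sum_k\partial_kw_k$, the divergence tested with $\varphi$ is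
$\sum_k\int(\partial_kw_k\,\partial_a\varphi-\partial_kw_a\,\partial_k\varphi)$, which vanishes by
weak commutation of derivatives and $\partial_aw_k=\partial_kw_a$. -/
theorem isDemagField_ball {R : ℝ} (hR : 0 < R) (a : Fin 3) :
    IsDemagField ((ball (0 : E3) R).indicator fun _ => EuclideanSpace.single a 1)
      (-ballField R a) := by
  refine ⟨(memLp_ballField hR a).neg, ?_, ?_⟩
  · intro φ hφ hc
    have hI := fun i k j => integrable_ballHessian_mul hR hφ hc i k j
    have e : ∀ᵐ x : E3, ∑ i, ((ball (0 : E3) R).indicator (fun _ => EuclideanSpace.single a (1 : ℝ)) x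
        + (-ballField R a) x : E3) i * partialDeriv i φ x
        = ∑ k, (ballHessian R k k x * partialDeriv a φ x
          - ballHessian R k a x * partialDeriv k φ x) := by
      filter_upwards [ae_norm_ne R] with x hx
      have h1 : ∀ i, ((ball (0 : E3) R).indicator (fun _ => EuclideanSpace.single a (1 : ℝ)) x) i
          = (if i = a then 1 else 0) * ∑ k, ballHessian R k k x := by
        intro i
        rw [sum_ballHessian hR hx]
        by_cases hb : x ∈ ball (0 : E3) R <;> simp [Set.indicator, hb]
      simp only [PiLp.add_apply, h1, Pi.neg_apply, PiLp.neg_apply, ballField, add_mul,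
        Finset.sum_add_distrib, Finset.sum_sub_distrib, ← Finset.sum_mul]
      simp [sub_eq_add_neg]
    rw [integral_congr_ae e, integral_finsetSum]
    · refine Finset.sum_eq_zero fun k _ => ?_
      rw [integral_sub (hI _ _ _) (hI _ _ _), sub_eq_zero]
      refine (integral_lineDeriv_mul_partialDeriv_comm (lipschitzWith_ballPotential hR k)
        hφ hc k a).trans (integral_congr_ae ?_)
      filter_upwards [ae_norm_ne R] with x hx
      have := ballHessian_symm hR hx a k
      simp only [ballHessian] at this ⊢
      rw [this]
    · exact fun k _ => (hI _ _ _).sub (hI _ _ _)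
  · intro φ hφ hc i j
    have := integral_lineDeriv_mul_partialDeriv_comm (lipschitzWith_ballPotential hR a) hφ hc j i
    have hI := fun i k j => integrable_ballHessian_mul hR hφ hc i k j
    simp only [Pi.neg_apply, PiLp.neg_apply, ballField, neg_mul]
    rw [integral_sub (f := fun x => -(ballHessian R j a x * partialDeriv i φ x))
      (g := fun x => -(ballHessian R i a x * partialDeriv j φ x)) (hI _ _ _).neg (hI _ _ _).neg, integral_neg, integral_neg, sub_eq_zero]
    exact congrArg Neg.neg this

/-- The projection of the uniform magnetization `c` of a ball equals `c / 3` inside the ball. -/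
theorem gradProj_indicator_ball {R : ℝ} (hR : 0 < R) (c : E3) :
    ∀ᵐ x : E3, x ∈ ball (0 : E3) R →
      gradProj ((memLp_indicator_ball (continuous_const (y := c)) R).toLp _) x = (1 / 3 : ℝ) • c := by
  set u : Fin 3 → L2Field := fun a =>
    (memLp_indicator_ball (continuous_const (y := EuclideanSpace.single a (1 : ℝ))) R).toLp _ with hu
  have hu' : ∀ a, MemLp ((ball (0 : E3) R).indicator fun _ => EuclideanSpace.single a (1 : ℝ)) 2
    volume := fun a => memLp_indicator_ball continuous_const R
  have hsum : (memLp_indicator_ball (continuous_const (y := c)) R).toLp _ = ∑ a, c a • u a := by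
    simp_rw [hu, Fin.sum_univ_three, ← MemLp.toLp_const_smul]
    rw [← MemLp.toLp_add, ← MemLp.toLp_add, MemLp.toLp_eq_toLp_iff]
    refine Eventually.of_forall fun x => ?_
    ext i
    by_cases hx : x ∈ ball (0 : E3) R
    · simp only [Pi.add_apply, Pi.smul_apply, Set.indicator_of_mem hx]
      fin_cases i <;> simp
    · simp [Set.indicator_of_notMem hx]
  have hproj : ∀ a, gradProj (u a) = (memLp_ballField hR a).toLp _ := by
    intro a
    have := (isDemagField_ball hR a).toLp_eq
      (memLp_indicator_ball (continuous_const (y := EuclideanSpace.single a (1 : ℝ))) R)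
    rw [MemLp.toLp_neg (memLp_ballField hR a), neg_inj] at this
    exact this.symm
  rw [hsum, map_sum]
  simp_rw [map_smul, hproj, Fin.sum_univ_three, ← MemLp.toLp_const_smul]
  rw [← MemLp.toLp_add, ← MemLp.toLp_add]
  filter_upwards [MemLp.coeFn_toLp ((((memLp_ballField hR 0).const_smul (c 0)).add
    ((memLp_ballField hR 1).const_smul (c 1))).add ((memLp_ballField hR 2).const_smul (c 2)))]
    with x hx hb
  rw [hx]
  rw [mem_ball_zero_iff] at hb
  ext i
  simp only [Pi.add_apply, Pi.smul_apply, PiLp.add_apply, PiLp.smul_apply, ballField,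
    ballHessian_of_norm_lt hb, smul_eq_mul]
  fin_cases i <;> simp <;> ring

/-! ### Magnetostatic energies on balls -/

/-- The second field vanishes outside the ball, so only the constant interior value $c/3$ of the
projection enters. -/
theorem inner_gradProj_indicator_ball {R : ℝ} (hR : 0 < R) (c : E3) {f : E3 → E3}
    (hf : MemLp ((ball (0 : E3) R).indicator f) 2 volume) :
    inner ℝ (gradProj ((memLp_indicator_ball (continuous_const (y := c)) R).toLp _)) (hf.toLp _)
      = 1 / 3 * ∫ x in ball (0 : E3) R, inner ℝ c (f x) := by
  rw [L2.inner_def, ← integral_const_mul, ← integral_indicator measurableSet_ball]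
  refine integral_congr_ae ?_
  filter_upwards [gradProj_indicator_ball hR c, hf.coeFn_toLp] with x h1 h2
  rw [h2]
  by_cases hx : x ∈ ball (0 : E3) R
  · rw [h1 hx, Set.indicator_of_mem hx, Set.indicator_of_mem hx, real_inner_smul_left]
  · rw [Set.indicator_of_notMem hx, Set.indicator_of_notMem hx, inner_zero_right]

theorem norm_gradProj_indicator_ball_sq {R : ℝ} (hR : 0 < R) (c : E3) :
    ‖gradProj ((memLp_indicator_ball (continuous_const (y := c)) R).toLp _)‖ ^ 2
      = ‖c‖ ^ 2 / 3 * volume.real (ball (0 : E3) R) := by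
  rw [← inner_gradProj_self, inner_gradProj_indicator_ball hR]
  simp
  ring

/-- The vertical unit vector. -/
noncomputable abbrev e₃ : E3 := EuclideanSpace.single 2 1

/-- This is the curl-free identity for $\nabla\psi$ tested with $\varphi$, read as a statement about
the field built from $\varphi$. -/
theorem weaklyDivFree_curlField {φ : E3 → ℝ} (hφ : ContDiff ℝ ∞ φ) (hc : HasCompactSupport φ)
    (i j : Fin 3) : WeaklyDivFree (curlField i j φ) := by
  intro ψ hψ _
  have := weaklyCurlFree_gradField hψ φ hφ hc i j
  simp_rw [← sum_mul_curlField, gradField] at this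
  simpa only [mul_comm] using this

/-- Tilting the magnetization by a divergence-free field lowers the magnetostatic energy. -/
theorem magnetostaticEnergy_tilt_le {R : ℝ} (hR : 0 < R) {q φ : E3 → ℝ} (hq : Continuous q)
    (hq0 : ∀ x, 0 ≤ q x) (hq1 : ∀ x, q x ≤ 1 / 3) (hφ : ContDiff ℝ ∞ φ) (hc : HasCompactSupport φ)
    (hsupp : ∀ x, x ∉ ball (0 : E3) R → curlField 1 0 φ x = 0) :
    magnetostaticEnergy (ball 0 R) (fun x => (1 - q x) • e₃ + curlField 1 0 φ x)
      ≤ 1 / 3 * volume.real (ball (0 : E3) R) - 1 / 3 * ∫ x in ball (0 : E3) R, q x := by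
  set v := curlField 1 0 φ with hv
  have hvL : MemLp v 2 volume := memLp_curlField hφ hc 1 0
  have heL := memLp_indicator_ball (continuous_const (y := e₃)) R
  have hqL : MemLp ((ball (0 : E3) R).indicator fun x => q x • e₃) 2 volume :=
    memLp_indicator_ball (hq.smul continuous_const) R
  have hsplit : (ball (0 : E3) R).indicator (fun x => (1 - q x) • e₃ + v x)
      = (ball (0 : E3) R).indicator (fun _ => e₃) - (ball (0 : E3) R).indicator (fun x => q x • e₃)
        + v := by
    ext1 x
    by_cases hx : x ∈ ball (0 : E3) R
    · simp [Set.indicator_of_mem hx, sub_smul]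
    · simp [Set.indicator_of_notMem hx, hsupp x hx]
  have hmL : MemLp ((ball (0 : E3) R).indicator (fun x => (1 - q x) • e₃ + v x)) 2 volume := by
    rw [hsplit]; exact (heL.sub hqL).add hvL
  have htoLp : hmL.toLp _ = heL.toLp _ - hqL.toLp _ + hvL.toLp _ := by
    rw [← MemLp.toLp_sub, ← MemLp.toLp_add]
    exact (MemLp.toLp_eq_toLp_iff _ _).2 (Eventually.of_forall fun x => congrFun hsplit x)
  have hcont : IntegrableOn q (ball (0 : E3) R) :=
    (hq.continuousOn.integrableOn_compact (isCompact_closedBall (0 : E3) R)).mono_set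
      ball_subset_closedBall
  have hcont2 : IntegrableOn (fun x => q x ^ 2) (ball (0 : E3) R) :=
    ((hq.pow 2).continuousOn.integrableOn_compact (isCompact_closedBall (0 : E3) R)).mono_set
      ball_subset_closedBall
  -- Here $q\le1/3$ enters: $q^2\le q/3$, so the quadratic term absorbs only half of the linear gain
  -- $\frac23\int q$.
  have hnorm : ‖hqL.toLp _‖ ^ 2 ≤ 1 / 3 * ∫ x in ball (0 : E3) R, q x := by
    have : ‖hqL.toLp _‖ ^ 2 = ∫ x in ball (0 : E3) R, q x ^ 2 := by
      rw [← real_inner_self_eq_norm_sq, inner_toLp, ← integral_indicator measurableSet_ball]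
      congr 1
      ext x
      by_cases hx : x ∈ ball (0 : E3) R <;> simp [hx, pow_two]
    rw [this, ← integral_const_mul]
    refine setIntegral_mono hcont2 (hcont.const_mul _) fun x => ?_
    have := mul_le_mul_of_nonneg_right (hq1 x) (hq0 x)
    simpa [pow_two] using this
  have hinner := inner_gradProj_indicator_ball hR e₃ hqL
  have he : ∀ x, inner ℝ e₃ (q x • e₃) = q x := fun x => by
    rw [real_inner_smul_right, real_inner_self_eq_norm_sq]; simp
  simp_rw [he] at hinner
  have hW := norm_gradProj_indicator_ball_sq hR e₃
  have hPq := norm_gradProj_le (hqL.toLp _)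
  rw [magnetostaticEnergy_eq measurableSet_ball hmL, htoLp, map_add, map_sub,
    gradProj_eq_zero_of_weaklyDivFree hvL (weaklyDivFree_curlField hφ hc 1 0), add_zero,
    norm_sub_sq_real, ← inner_gradProj_left, gradProj_gradProj, hinner, hW]
  have : ‖gradProj (hqL.toLp _)‖ ^ 2 ≤ ‖hqL.toLp _‖ ^ 2 :=
    pow_le_pow_left₀ (norm_nonneg _) hPq 2
  have h1 : ‖e₃‖ = 1 := by simp
  rw [h1]
  linarith

/-! ### The competitor -/

/-- The range $s\le1/2$ suffices because $1-1/\sqrt2<1/3$. -/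
theorem sqrt_profile {s : ℝ} (h0 : 0 ≤ s) (h1 : s ≤ 1 / 2) :
    0 ≤ 1 - √(1 - s) ∧ 1 - √(1 - s) ≤ 1 / 3 ∧ (1 - √(1 - s) = 0 → s = 0) := by
  have hs : √(1 - s) ^ 2 = 1 - s := Real.sq_sqrt (by linarith)
  have hs0 := Real.sqrt_nonneg (1 - s)
  refine ⟨by nlinarith, by nlinarith, fun h => ?_⟩
  have : √(1 - s) = 1 := by linarith
  rw [this] at hs
  linarith

/-- The field $v=(\partial_1\varphi,-\partial_0\varphi,0)$ is horizontal, so unit length only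
requires the vertical component $\sqrt{1-|v|^2}=1-q$. A small multiple of a bump function serves as
$\varphi$. -/
theorem exists_tilt : ∃ φ q : E3 → ℝ, ContDiff ℝ ∞ φ ∧ HasCompactSupport φ ∧ Continuous q ∧
    (∀ x, 0 ≤ q x) ∧ (∀ x, q x ≤ 1 / 3) ∧ (∀ x, x ∉ ball (0 : E3) 1 → curlField 1 0 φ x = 0) ∧
    (∀ x, x ∉ ball (0 : E3) 1 → q x = 0) ∧ 0 < ∫ x, q x ∧
    (∀ x, ‖(1 - q x) • e₃ + curlField 1 0 φ x‖ = 1) ∧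
    ∃ K : NNReal, LipschitzWith K fun x => (1 - q x) • e₃ + curlField 1 0 φ x := by
  let b : ContDiffBump (0 : E3) := ⟨1 / 4, 1 / 2, by norm_num, by norm_num⟩
  have hbs : ContDiff ℝ ∞ b := b.contDiff
  have hbc : HasCompactSupport b := b.hasCompactSupport
  have hbd : ∀ i, ∃ C, ∀ x, ‖partialDeriv i b x‖ ≤ C := fun i =>
    (continuous_partialDeriv hbs i).bounded_above_of_compact_support
      (hasCompactSupport_partialDeriv hbc i)
  choose C hC using hbd
  have hC0 : ∀ i, 0 ≤ C i := fun i => (norm_nonneg _).trans (hC i 0)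
  -- This makes both horizontal derivatives of $\varphi$ at most $1/2$ in absolute value, so
  -- $s=|v|^2\le1/2$.
  set ε : ℝ := (2 * (1 + C 0 + C 1))⁻¹ with hε
  have hCsum : 0 < 1 + C 0 + C 1 := by linarith [hC0 0, hC0 1]
  have hε0 : 0 < ε := by positivity
  set φ : E3 → ℝ := fun x => ε * b x with hφd
  have hφ : ContDiff ℝ ∞ φ := contDiff_const.mul hbs
  have hφc : HasCompactSupport φ := hbc.mul_left
  have hpd : ∀ i x, partialDeriv i φ x = ε * partialDeriv i b x := by
    intro i x
    rw [hφd, partialDeriv_mul (f := fun _ => ε) (differentiable_const _)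
      (hbs.differentiable (by simp))]
    simp [partialDeriv]
  have hz : ∀ x, x ∉ ball (0 : E3) 1 → ∀ i, partialDeriv i φ x = 0 := by
    intro x hx i
    rw [hpd]
    unfold partialDeriv
    rw [fderiv_of_notMem_tsupport ℝ]
    · simp
    · rw [b.tsupport_eq]
      intro h
      rw [mem_closedBall_zero_iff] at h
      rw [mem_ball_zero_iff] at hx
      have : ‖x‖ ≤ 1 / 2 := h
      linarith
  set s : E3 → ℝ := fun x => partialDeriv 0 φ x ^ 2 + partialDeriv 1 φ x ^ 2 with hs
  have hs0 : ∀ x, 0 ≤ s x := fun x => by positivity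
  have hsmall : ∀ i : Fin 3, (i = 0 ∨ i = 1) → ∀ x, partialDeriv i φ x ^ 2 ≤ 1 / 4 := by
    intro i hi x
    have h1 : |partialDeriv i φ x| ≤ 1 / 2 := by
      rw [hpd, abs_mul, abs_of_pos hε0, hε, inv_mul_le_iff₀ (by positivity)]
      have := hC i x
      rw [Real.norm_eq_abs] at this
      rcases hi with rfl | rfl <;> linarith [hC0 0, hC0 1]
    rw [← sq_abs]
    nlinarith [abs_nonneg (partialDeriv i φ x)]
  have hs1 : ∀ x, s x ≤ 1 / 2 := fun x => by
    have h0 := hsmall 0 (Or.inl rfl) x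
    have h1 := hsmall 1 (Or.inr rfl) x
    simp only [hs]
    linarith
  have hsc : ContDiff ℝ ∞ s :=
    ((contDiff_partialDeriv hφ 0).pow 2).add ((contDiff_partialDeriv hφ 1).pow 2)
  set q : E3 → ℝ := fun x => 1 - √(1 - s x) with hq
  have hqs : ContDiff ℝ ∞ q :=
    contDiff_const.sub ((contDiff_const.sub hsc).sqrt fun x => by linarith [hs1 x])
  have hqz : ∀ x, x ∉ ball (0 : E3) 1 → q x = 0 := by
    intro x hx
    simp [hq, hs, hz x hx]
  have hvz : ∀ x, x ∉ ball (0 : E3) 1 → curlField 1 0 φ x = 0 := by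
    intro x hx
    simp [curlField, hz x hx]
  have hcs : ∀ {F : Type} [NormedAddCommGroup F] (g : E3 → F),
      (∀ x, x ∉ ball (0 : E3) 1 → g x = 0) → HasCompactSupport g := by
    intro F _ g hg
    exact HasCompactSupport.intro (isCompact_closedBall (0 : E3) 1) fun x hx =>
      hg x fun h => hx (ball_subset_closedBall h)
  refine ⟨φ, q, hφ, hφc, hqs.continuous, fun x => (sqrt_profile (hs0 x) (hs1 x)).1,
    fun x => (sqrt_profile (hs0 x) (hs1 x)).2.1, hvz, hqz, ?_, ?_, ?_⟩
  · refine (integral_nonneg fun x => (sqrt_profile (hs0 x) (hs1 x)).1).lt_of_ne' fun h => ?_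
    have hq_zero : q = 0 := by
      have := (integral_eq_zero_iff_of_nonneg
        (fun x => (sqrt_profile (hs0 x) (hs1 x)).1)
        (hqs.continuous.integrable_of_hasCompactSupport (hcs q hqz))).1 h
      exact (Continuous.ae_eq_iff_eq volume hqs.continuous continuous_const).1 this
    -- If $\int q=0$ then $v=0$ and $\varphi$ is constant along the first axis, but it equals
    -- $\varepsilon$ at the origin and 0 at distance 1.
    have hp : ∀ x, partialDeriv 0 φ x = 0 := by
      intro x
      have h1 := (sqrt_profile (hs0 x) (hs1 x)).2.2 (congrFun hq_zero x)
      simp only [hs] at h1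
      have h2 := sq_nonneg (partialDeriv 0 φ x)
      have h3 := sq_nonneg (partialDeriv 1 φ x)
      exact pow_eq_zero_iff two_ne_zero |>.1 (by linarith)
    set w : E3 := EuclideanSpace.single 0 1 with hw
    have hder : ∀ t : ℝ, HasDerivAt (fun t : ℝ => φ (t • w)) 0 t := by
      intro t
      have h1 : HasDerivAt (fun t : ℝ => t • w) w t := by
        simpa using (hasDerivAt_id t).smul_const w
      have := ((hφ.differentiable (by simp)) (t • w)).hasFDerivAt.comp_hasDerivAt t h1
      exact this.congr_deriv (hp (t • w))
    have hconst := is_const_of_deriv_eq_zero (fun t => (hder t).differentiableAt)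
      (fun t => (hder t).deriv) 0 1
    have hb0 : b 0 = 1 := b.one_of_mem_closedBall (by simp [b])
    have hb1 : b w = 0 := b.zero_of_le_dist (by simp [hw, b]; norm_num)
    simp only [hφd, zero_smul, one_smul, hb0, hb1] at hconst
    linarith
  · intro x
    have h1 : √(1 - s x) ^ 2 = 1 - s x := Real.sq_sqrt (by linarith [hs1 x])
    have h2 : ‖(1 - q x) • e₃ + curlField 1 0 φ x‖ ^ 2 = 1 := by
      rw [EuclideanSpace.real_norm_sq_eq, Fin.sum_univ_three]
      simp [curlField, hq, h1]
      simp [hs]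
      ring
    exact (pow_eq_one_iff_of_nonneg (norm_nonneg _) two_ne_zero).1 h2
  · set g : E3 → E3 := fun x => curlField 1 0 φ x - q x • e₃ with hg
    have hgs : ContDiff ℝ 1 g := by
      refine ContDiff.of_le (n := ∞) ?_ (by simp)
      exact (((contDiff_partialDeriv hφ 1).smul contDiff_const).sub
        ((contDiff_partialDeriv hφ 0).smul contDiff_const)).sub (hqs.smul contDiff_const)
    obtain ⟨K, hK⟩ := hgs.lipschitzWith_of_hasCompactSupport
      (hcs g fun x hx => by simp [hg, hvz x hx, hqz x hx]) (by simp)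
    refine ⟨K, fun x y => ?_⟩
    have := hK x y
    have e : ∀ x, (1 - q x) • e₃ + curlField 1 0 φ x = e₃ + g x := fun x => by
      simp only [hg]; module
    simp only [e, edist_add_left]
    exact this

/-! ### Smallness of the rescaled exchange energy -/

/-- The exchange density of a rescaled Lipschitz unit field. -/
noncomputable def exchangeBound (j : E3 → ℝ≥0∞) (K : NNReal) (R : ℝ) : ℝ≥0∞ :=
  ∫⁻ z, j z * min 4 ((K * (‖R⁻¹‖ₑ * ‖z‖ₑ)) ^ 2)

/-- The difference of values is at most both 2 and $K|x-y|/R$. Enlarging the inner domain to the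
whole space and substituting $z=x-y$ decouples the integrals. -/
theorem exchangeEnergy_rescale_le {j : E3 → ℝ≥0∞} (hj : Measurable j) {m : E3 → E3} {K : NNReal}
    (hm : ∀ x, ‖m x‖ = 1) (hK : LipschitzWith K m) (R : ℝ) (Ω : Set E3) :
    exchangeEnergy j Ω (fun x => m (R⁻¹ • x)) ≤ volume Ω * exchangeBound j K R := by
  set k : E3 → ℝ≥0∞ := fun z => j z * min 4 ((K * (‖R⁻¹‖ₑ * ‖z‖ₑ)) ^ 2) with hk
  have hkm : Measurable k := by fun_prop
  have hle : ∀ p : E3 × E3, j (p.1 - p.2) * ‖m (R⁻¹ • p.1) - m (R⁻¹ • p.2)‖ₑ ^ 2 ≤ k (p.1 - p.2) := by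
    intro p
    refine mul_le_mul_right (le_min ?_ ?_) _
    · have h1 : ‖m (R⁻¹ • p.1) - m (R⁻¹ • p.2)‖ ≤ 2 :=
        (norm_sub_le _ _).trans (by rw [hm, hm]; norm_num)
      have h2 : ‖m (R⁻¹ • p.1) - m (R⁻¹ • p.2)‖ₑ ≤ 2 := by
        rw [← ofReal_norm]
        exact ENNReal.ofReal_le_of_le_toReal (by simpa using h1)
      calc _ ≤ (2 : ℝ≥0∞) ^ 2 := by gcongr
        _ = 4 := by norm_num
    · have h := hK (R⁻¹ • p.1) (R⁻¹ • p.2)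
      rw [edist_eq_enorm_sub, edist_eq_enorm_sub, ← smul_sub, enorm_smul] at h
      gcongr
  calc exchangeEnergy j Ω (fun x => m (R⁻¹ • x))
      ≤ ∫⁻ p in Ω ×ˢ Ω, k (p.1 - p.2) := lintegral_mono fun p => hle p
    _ = ∫⁻ x in Ω, ∫⁻ y in Ω, k (x - y) := by
        rw [Measure.volume_eq_prod, ← Measure.prod_restrict, lintegral_prod]
        exact (hkm.comp (measurable_fst.sub measurable_snd)).aemeasurable
    _ ≤ ∫⁻ x in Ω, ∫⁻ y, k (x - y) :=
        lintegral_mono fun x => setLIntegral_le_lintegral _ _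
    _ = volume Ω * exchangeBound j K R := by
        simp_rw [lintegral_sub_left_eq_self k]
        rw [lintegral_const, Measure.restrict_apply_univ, mul_comm]
        rfl

/-- For $R\ge1$ the integrand is dominated by $(4+K^2)\min\{1,|z|^2\}j(z)$. -/
theorem tendsto_exchangeBound {j : E3 → ℝ≥0∞} (hj : Measurable j)
    (J2 : ∫⁻ z, min 1 (‖z‖ₑ ^ 2) * j z < ⊤) (K : NNReal) :
    Tendsto (exchangeBound j K) atTop (𝓝 0) := by
  have hfin : ∀ᵐ z : E3, min 1 (‖z‖ₑ ^ 2) * j z < ⊤ := ae_lt_top (by fun_prop) J2.ne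
  have hinv : Tendsto (fun R : ℝ => ‖R⁻¹‖ₑ) atTop (𝓝 0) := by
    have h : Tendsto (fun R : ℝ => ‖R⁻¹‖ₑ) atTop (𝓝 ‖(0 : ℝ)‖ₑ) :=
      (continuous_enorm.tendsto (0 : ℝ)).comp tendsto_inv_atTop_zero
    simpa using h
  set D : ℝ≥0∞ := 4 + (K : ℝ≥0∞) ^ 2 with hD
  have hDtop : D ≠ ⊤ := by simp [hD]
  have h := tendsto_lintegral_filter_of_dominated_convergence (μ := (volume : Measure E3))
    (l := (atTop : Filter ℝ)) (F := fun (R : ℝ) z => j z * min 4 ((K * (‖R⁻¹‖ₑ * ‖z‖ₑ)) ^ 2)) (f := fun _ => 0)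
    (fun z => D * (min 1 (‖z‖ₑ ^ 2) * j z)) ?_ ?_ ?_ ?_
  · rwa [lintegral_zero] at h
  · exact Eventually.of_forall fun R => by fun_prop
  · filter_upwards [eventually_ge_atTop 1] with R hR
    refine Eventually.of_forall fun z => ?_
    have hR1 : ‖R⁻¹‖ₑ ≤ 1 := by
      rw [← ofReal_norm, ENNReal.ofReal_le_one, norm_inv, Real.norm_of_nonneg (by linarith)]
      exact inv_le_one_of_one_le₀ hR
    rw [mul_comm, ← mul_assoc D]
    refine mul_le_mul_left ?_ _
    rcases le_total 1 (‖z‖ₑ ^ 2) with hz | hz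
    · rw [min_eq_left hz, mul_one]
      exact (min_le_left _ _).trans le_self_add
    · rw [min_eq_right hz]
      refine (min_le_right _ _).trans ?_
      calc (K * (‖R⁻¹‖ₑ * ‖z‖ₑ)) ^ 2 ≤ (K * (1 * ‖z‖ₑ)) ^ 2 := by gcongr
        _ = K ^ 2 * ‖z‖ₑ ^ 2 := by rw [one_mul, mul_pow]
        _ ≤ D * ‖z‖ₑ ^ 2 := by gcongr; exact le_add_self
  · rw [lintegral_const_mul' _ _ hDtop]
    exact (ENNReal.mul_lt_top hDtop.lt_top J2).ne
  · filter_upwards [hfin] with z hz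
    -- At $z=0$, $j$ may be infinite but its factor is 0, and $\infty\cdot0=0$. Elsewhere (J2) makes
    -- $j$ finite almost everywhere, so the product tends to 0.
    rcases eq_or_ne z 0 with rfl | hz0
    · simp
    · have hjz : j z ≠ ⊤ := by
        intro htop
        rw [htop, ENNReal.mul_top] at hz
        · exact lt_irrefl _ hz
        · simp [hz0]
      have h1 : Tendsto (fun R : ℝ => ((K : ℝ≥0∞) * (‖R⁻¹‖ₑ * ‖z‖ₑ)) ^ 2) atTop (𝓝 0) := by
        have h2 : Tendsto (fun R : ℝ => ‖R⁻¹‖ₑ * ‖z‖ₑ) atTop (𝓝 0) := by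
          simpa using ENNReal.Tendsto.mul_const hinv (Or.inr (enorm_ne_top (x := z)))
        have h3 : Tendsto (fun R : ℝ => (K : ℝ≥0∞) * (‖R⁻¹‖ₑ * ‖z‖ₑ)) atTop (𝓝 0) := by
          simpa using ENNReal.Tendsto.const_mul h2 (Or.inr ENNReal.coe_ne_top)
        simpa using ENNReal.Tendsto.pow (n := 2) h3
      have h4 : Tendsto (fun R : ℝ => min 4 (((K : ℝ≥0∞) * (‖R⁻¹‖ₑ * ‖z‖ₑ)) ^ 2)) atTop (𝓝 0) := by
        simpa using (tendsto_const_nhds (x := (4 : ℝ≥0∞))).min h1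
      simpa using ENNReal.Tendsto.const_mul h4 (Or.inr hjz)

/-! ### Constant fields do not minimize on large balls -/

theorem magnetostaticEnergy_of_ae_eq_const {R : ℝ} (hR : 0 < R) {m : E3 → E3} {c : E3}
    (h : ∀ᵐ x ∂volume.restrict (ball (0 : E3) R), m x = c) :
    magnetostaticEnergy (ball 0 R) m = ‖c‖ ^ 2 / 3 * volume.real (ball (0 : E3) R) := by
  have hae : (ball (0 : E3) R).indicator (fun _ => c) =ᵐ[volume] (ball (0 : E3) R).indicator m := by
    rw [ae_restrict_iff' measurableSet_ball] at h
    filter_upwards [h] with x hx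
    by_cases hb : x ∈ ball (0 : E3) R
    · simp [hb, hx hb]
    · simp [hb]
  have hc := memLp_indicator_ball (continuous_const (y := c)) R
  have hm := hc.ae_eq hae
  rw [magnetostaticEnergy_eq measurableSet_ball hm, ← norm_gradProj_indicator_ball_sq hR c,
    (MemLp.toLp_eq_toLp_iff hm hc).2 hae.symm]

end Micromagnetics

/-! ### Energy comparison on large balls -/

open Micromagnetics Filter Topology in
theorem mainTheorem4 (j : Micromagnetics.E3 → ℝ≥0∞) (hj : Measurable j)
    (J1 : ∀ z, j (-z) = j z)
    (J2 : ∫⁻ z, min 1 (‖z‖ₑ ^ 2) * j z < ⊤)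
    (J3 : ∀ R : ℝ, 0 < R → ∫⁻ z in ball (0 : Micromagnetics.E3) R, j z = ⊤) :
    ∃ Rcrit : ℝ, 0 < Rcrit ∧ ∀ R : ℝ, Rcrit ≤ R → ∀ m : Micromagnetics.E3 → Micromagnetics.E3,
      Micromagnetics.IsMinimizer j (ball 0 R) m →
        ¬ Micromagnetics.IsConstantOn (ball 0 R) m := by
  obtain ⟨φ, q, hφ, hφc, hq, hq0, hq1, hvz, hqz, hδ, hunit, K, hK⟩ := exists_tilt
  set δ := ∫ x, q x with hδd
  have hV : volume (ball (0 : E3) 1) ≠ ⊤ := measure_ball_lt_top.ne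
  have hlim : Tendsto (fun R => volume (ball (0 : E3) 1) * exchangeBound j K R) atTop (𝓝 0) := by
    simpa using ENNReal.Tendsto.const_mul (tendsto_exchangeBound hj J2 K) (Or.inr hV)
  -- The threshold $\delta/3$ is the magnetostatic gain per factor $R^3$.
  obtain ⟨R₀, hR₀⟩ := eventually_atTop.1
    (hlim.eventually_lt_const (u := ENNReal.ofReal (δ / 3)) (by simpa using hδ))
  refine ⟨max R₀ 1, by positivity, fun R hR m hmin hconst => ?_⟩
  have hRpos : 0 < R := one_pos.trans_le ((le_max_right _ _).trans hR)
  obtain ⟨c, hc⟩ := hconst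
  have hcn : ‖c‖ = 1 := by
    have hne : volume.restrict (ball (0 : E3) R) ≠ 0 := by
      rw [Ne, Measure.restrict_eq_zero]
      exact (measure_ball_pos _ _ hRpos).ne'
    have : (ae (volume.restrict (ball (0 : E3) R))).NeBot := ae_neBot.2 hne
    obtain ⟨x, h1, h2⟩ := (hc.and hmin.1.2.1).exists
    rw [h1] at h2
    simpa using h2
  set n : E3 → E3 := fun x => (1 - q x) • e₃ + curlField 1 0 φ x with hn
  set n' : E3 → E3 := fun x => n (R⁻¹ • x) with hn'
  have hex : exchangeEnergy j (ball 0 R) n' < ENNReal.ofReal (R ^ 3 * (δ / 3)) := by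
    refine (exchangeEnergy_rescale_le hj hunit hK R _).trans_lt ?_
    rw [Measure.addHaar_ball _ _ hRpos.le, mul_assoc, ENNReal.ofReal_mul (by positivity)]
    have : Module.finrank ℝ E3 = 3 := by simp
    rw [this]
    exact ENNReal.mul_lt_mul_right (by simpa using pow_pos hRpos 3) ENNReal.ofReal_ne_top
      (hR₀ R ((le_max_left _ _).trans hR))
  have hadm : n' ∈ admissible j (ball 0 R) := by
    refine ⟨?_, ?_, hex.trans ENNReal.ofReal_lt_top⟩
    · rw [← memLp_indicator_iff_restrict measurableSet_ball]
      exact memLp_indicator_ball (hK.continuous.comp (continuous_const_smul _)) R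
    · exact Eventually.of_forall fun x => by simpa using hunit (R⁻¹ • x)
  have hmagn : magnetostaticEnergy (ball 0 R) n'
      ≤ 1 / 3 * volume.real (ball (0 : E3) R) - 1 / 3 * (R ^ 3 * δ) := by
    have hout : ∀ x, x ∉ ball (0 : E3) R → R⁻¹ • x ∉ ball (0 : E3) 1 := by
      intro x hx
      rw [mem_ball_zero_iff, not_lt] at hx ⊢
      rw [norm_smul, norm_inv, Real.norm_of_nonneg hRpos.le, le_inv_mul_iff₀ hRpos]
      simpa using hx
    -- The prefactor $R$ compensates the chain rule, so the tilt keeps its amplitude under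
    -- rescaling.
    have hcurl : ∀ x, curlField 1 0 (fun y => R * φ (R⁻¹ • y)) x = curlField 1 0 φ (R⁻¹ • x) := by
      have hp : ∀ i x, partialDeriv i (fun y => R * φ (R⁻¹ • y)) x = partialDeriv i φ (R⁻¹ • x) := by
        intro i x
        rw [partialDeriv_mul (f := fun _ => R) (g := fun y => φ (R⁻¹ • y)) (differentiable_const _)
          ((hφ.comp (contDiff_const_smul R⁻¹)).differentiable (by simp)), partialDeriv_comp_smul]
        simp [partialDeriv]
        field_simp
      intro x
      simp [curlField, hp]
    have h := magnetostaticEnergy_tilt_le hRpos (q := fun x => q (R⁻¹ • x))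
      (φ := fun y => R * φ (R⁻¹ • y)) (hq.comp (continuous_const_smul _)) (fun x => hq0 _)
      (fun x => hq1 _) (contDiff_const.mul (hφ.comp (contDiff_const_smul R⁻¹)))
      (HasCompactSupport.mul_left
        (hφc.comp_homeomorph (Homeomorph.smulOfNeZero R⁻¹ (by positivity))))
      (fun x hx => by rw [hcurl]; exact hvz _ (hout x hx))
    simp_rw [hcurl] at h
    have hint : ∫ x in ball (0 : E3) R, q (R⁻¹ • x) = R ^ 3 * δ := by
      rw [setIntegral_eq_integral_of_forall_compl_eq_zero fun x hx => hqz _ (hout x hx),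
        Measure.integral_comp_inv_smul]
      simp [abs_of_pos hRpos, hδd]
    rwa [hint] at h
  have hle : totalEnergy j (ball 0 R) m ≤ totalEnergy j (ball 0 R) n' := hmin.2 hadm
  have hm : magnetostaticEnergy (ball 0 R) m = 1 / 3 * volume.real (ball (0 : E3) R) := by
    rw [magnetostaticEnergy_of_ae_eq_const hRpos hc, hcn]
    norm_num
  have hexr : (exchangeEnergy j (ball 0 R) n').toReal < R ^ 3 * (δ / 3) :=
    (ENNReal.toReal_lt_of_lt_ofReal hex)
  -- Nonnegativity of the exchange energy of the constant field suffices for the contradiction; its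
  -- vanishing is not needed.
  have h0 : 0 ≤ (exchangeEnergy j (ball 0 R) m).toReal := ENNReal.toReal_nonneg
  unfold totalEnergy at hle
  linarith
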